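/- Let $\mathbb X=\{(a,b):a>0,\ b\in\mathbb R\}$ be the $ax+b$ group, with product $(a,b)(c,d)=(ac,ad+b)$, and let $\mu(da\,db)=a^{-2}\,da\,db$. Then $\mu$ is a left Haar measure on $\mathbb X$ that is not right-invariant, i.e. $\mathbb X$ is not unimodular. Let $\lambda,\delta>0$ satisfy $2\delta\lambda<1$, and let $\mathfrak m$ be a homogeneous Poisson point process on $\mathbb X$ of intensity $\lambda$, i.e. with intensity measure $\lambda\mu$; identify $\mathfrak m$ with its set of points. For $X=(a,b)\in\mathbb X$ put $S(X)=[a,\infty)\times[b-\delta a,\,b+\delta a]$. The strip point-shift $H$ sends $X\in\mathfrak m$ to the point $H(X)$ of $\mathfrak m\cap S(X)$ with the largest first coordinate (ties being resolved lexicographically). Let $G$ be the graph on $\mathfrak m$ with an edge from each $X$ to $H(X)$; components are the undirected connected components of $G$, and the foil of $X$ is $\{Y\in\mathfrak m:\exists n\ge 0,\ H^n(X)=H^n(Y)\}$. A point of $\mathfrak m$ is primeval if it lies in $H^n(\mathfrak m)$ for every $n\ge 0$. Almost surely, the following hold. 1. For every $X\in\mathfrak m$, $\mathfrak m(S(X))<\infty$,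 and $H(X)$ is the unique point of $\mathfrak m\cap S(X)$ with the largest first coordinate, so no ties occur. 2. For every $X\in\mathfrak m$ the sequence $(H^n(X))_{n\ge 0}$ is eventually constant. 3. Every fixed point of $H$ in $\mathfrak m$ is the image under $H$ of infinitely many points of $\mathfrak m$. 4. The foil of each point equals its component. Each component contains exactly one fixed point of $H$, and the component of a fixed point $Y$ is $\{X\in\mathfrak m: \exists n\ge 0,\ H^n(X)=Y\}$. 5. Fixed points of $H$ exist in $\mathfrak m$, and every fixed point is primeval. 6. Every component is infinite and all of its foils are infinite (type $\mathcal I/\mathcal I$); nevertheless every component contains a cycle of $G$ (a fixed point of $H$) and a primeval point. Consequently, almost surely no component satisfies the conclusion of the cardinality classification valid for point-shifts on unimodular groups, namely that a component $C$ belongs to one of the following three classes: - $\mathcal F/\mathcal F$: $C$ is finite, it has a unique cycle, whose length is the number of foils of $C$, and the primeval points of $C$ are the vertices of this cycle; - $\mathcal I/\mathcal F$: $C$ is infinite and acyclic, all its foils are finite, for each foil $L$ of $C$ there is $Y\in\mathfrak m$ with $H(Y)\in L$, and the primeval points of $C$ form a bi-infinite path $(X_n)_{n\in\mathbb Z}$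 with $H(X_n)=X_{n+1}$, unique up to shifting the index; - $\mathcal I/\mathcal I$: $C$ is infinite and acyclic, all its foils are infinite, and $C$ contains no primeval point. -/

import Mathlib

open MeasureTheory ProbabilityTheory
open scoped ENNReal

/-! ### The `ax+b` group -/

/-- The `ax+b` group: the matrices `(a b; 0 1)` with `a > 0` and `b` real, identified with the
points `(a, b)` of the open right half-plane (with the topology of the plane). -/
def AxB : Type := {p : ℝ × ℝ // 0 < p.1}

namespace AxB

instance : TopologicalSpace AxB := inferInstanceAs (TopologicalSpace {p : ℝ × ℝ // 0 < p.1})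

instance : MeasurableSpace AxB := inferInstanceAs (MeasurableSpace {p : ℝ × ℝ // 0 < p.1})

instance : BorelSpace AxB := inferInstanceAs (BorelSpace {p : ℝ × ℝ // 0 < p.1})

/-- The diagonal coordinate `a > 0` (the first, i.e. horizontal, coordinate). -/
def a (x : AxB) : ℝ := x.1.1

/-- The off-diagonal coordinate `b` (the second, i.e. vertical, coordinate). -/
def b (x : AxB) : ℝ := x.1.2

theorem a_pos (x : AxB) : 0 < x.a := x.2

@[ext] theorem ext {x y : AxB} (ha : x.a = y.a) (hb : x.b = y.b) : x = y :=
  Subtype.ext (Prod.ext ha hb)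

/-- Matrix multiplication, `(a, b) (c, d) = (a c, a d + b)`. -/
instance : Mul AxB := ⟨fun x y => ⟨(x.a * y.a, x.a * y.b + x.b), mul_pos x.a_pos y.a_pos⟩⟩

/-- The identity matrix is the point `(1, 0)`. -/
instance : One AxB := ⟨⟨(1, 0), one_pos⟩⟩

/-- Matrix inverse, `(a, b)⁻¹ = (1 / a, - b / a)`. -/
noncomputable instance : Inv AxB := ⟨fun x => ⟨(1 / x.a, -x.b / x.a), one_div_pos.2 x.a_pos⟩⟩

@[simp] theorem mul_a (x y : AxB) : (x * y).a = x.a * y.a := rfl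
@[simp] theorem mul_b (x y : AxB) : (x * y).b = x.a * y.b + x.b := rfl
@[simp] theorem one_a : (1 : AxB).a = 1 := rfl
@[simp] theorem one_b : (1 : AxB).b = 0 := rfl
@[simp] theorem inv_a (x : AxB) : (x⁻¹).a = 1 / x.a := rfl
@[simp] theorem inv_b (x : AxB) : (x⁻¹).b = -x.b / x.a := rfl

noncomputable instance : Group AxB :=
  Group.ofLeftAxioms
    (fun x y z => by ext <;> simp <;> ring)
    (fun x => by ext <;> simp)
    (fun x => by
      have h := x.a_pos.ne'
      ext
      · simp [h]
      · simp only [mul_b, inv_a, inv_b, one_b]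
        ring)

/-- The measure `a⁻² da db` on the `ax+b` group. -/
noncomputable def haar : Measure AxB :=
  Measure.comap (Subtype.val : {p : ℝ × ℝ // 0 < p.1} → ℝ × ℝ)
    ((volume : Measure (ℝ × ℝ)).withDensity fun p => ENNReal.ofReal (1 / p.1 ^ 2))

/-- The strip `S(a, b) = [a, ∞) × [b - δ a, b + δ a]`. -/
def strip (δ : ℝ) (x : AxB) : Set AxB :=
  {y | x.a ≤ y.a ∧ x.b - δ * x.a ≤ y.b ∧ y.b ≤ x.b + δ * x.a}

/-- `y` is the right-most point of the configuration `N` in the strip at `x`, ties being resolved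
by the lexicographic order on coordinates. -/
def IsRightmost (δ : ℝ) (N : Set AxB) (x y : AxB) : Prop :=
  y ∈ N ∩ strip δ x ∧ ∀ z ∈ N ∩ strip δ x, z.a < y.a ∨ (z.a = y.a ∧ z.b ≤ y.b)

open Classical in
/-- The strip point-shift of the configuration `N`: a point `x` of `N` is sent to the right-most
point of `N` in the strip at `x`. It is the identity off `N` (and, by convention, at points whose
strip has no right-most point). -/
noncomputable def stripShift (δ : ℝ) (N : Set AxB) (x : AxB) : AxB :=
  if h : x ∈ N ∧ ∃ y, IsRightmost δ N x y then h.2.choose else x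

end AxB

/-! ### Point processes -/

section PointProcess

variable {Ω α : Type*} [MeasurableSpace Ω] [TopologicalSpace α] [MeasurableSpace α]

/-- A point process: a random element (for the `σ`-algebra generated by the evaluations
`μ ↦ μ B`) of the space of locally finite counting measures. -/
structure IsPointProcess (m : Ω → Measure α) : Prop where
  measurable : Measurable m
  locallyFinite : ∀ ω, IsLocallyFiniteMeasure (m ω)
  counting : ∀ ω, ∃ (ι : Type) (_ : Countable ι) (x : ι → α),
    m ω = Measure.sum fun i => Measure.dirac (x i)

/-- A Poisson point process with intensity measure `Λ`. -/
structure IsPoissonProcess (P : Measure Ω) (m : Ω → Measure α) (Λ : Measure α) : Prop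
    extends IsPointProcess m where
  poisson : ∀ B : Set α, MeasurableSet B → Λ B ≠ ∞ →
    P.map (fun ω => m ω B) = (poissonMeasure (Λ B).toNNReal).map (fun k : ℕ => (k : ℝ≥0∞))
  indep : ∀ (n : ℕ) (B : Fin n → Set α), (∀ i, MeasurableSet (B i)) →
    Pairwise (fun i j => Disjoint (B i) (B j)) → iIndepFun (fun i ω => m ω (B i)) P

/-- The set of points (atoms) of a counting measure. -/
def pointsOf (μ : Measure α) : Set α := {x | μ {x} ≠ 0}

end PointProcess

/-! ### The graph of a point-shift -/

namespace PointShift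

variable {α : Type*}

/-- Points fixed by `H`. -/
def fixedPts (N : Set α) (H : α → α) : Set α := {x ∈ N | H x = x}

/-- The primeval points: those in the image `H^n(N)` for every `n`. -/
def primeval (N : Set α) (H : α → α) : Set α := ⋂ n : ℕ, H^[n] '' N

/-- The undirected connected component of `x` in the graph with vertex set `N` and an edge from
each `u` to `H u`. -/
def component (N : Set α) (H : α → α) (x : α) : Set α :=
  {y ∈ N | Relation.EqvGen (fun u v => u ∈ N ∧ v ∈ N ∧ H u = v) x y}

/-- The set of connected components. -/
def components (N : Set α) (H : α → α) : Set (Set α) := component N H '' N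

/-- The foil of `x`: the points having a common `n`-th iterate with `x`, for some `n`. -/
def foil (N : Set α) (H : α → α) (x : α) : Set α := {y ∈ N | ∃ n : ℕ, H^[n] x = H^[n] y}

/-- The foils of the points of `C`. -/
def foilsIn (N : Set α) (H : α → α) (C : Set α) : Set (Set α) := foil N H '' C

/-- `K` is the vertex set of a directed cycle of length `n ≥ 1`. -/
def IsCycle (H : α → α) (n : ℕ) (K : Set α) : Prop :=
  0 < n ∧ ∃ x, Function.minimalPeriod H x = n ∧ K = Set.range fun i : ℕ => H^[i] x

/-- `C` contains no directed cycle. -/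
def Acyclic (H : α → α) (C : Set α) : Prop := ∀ n K, IsCycle H n K → ¬ K ⊆ C

/-- Type `I/I`: `C` is infinite and all its foils are infinite. -/
def TypeII (N : Set α) (H : α → α) (C : Set α) : Prop :=
  C.Infinite ∧ ∀ L ∈ foilsIn N H C, L.Infinite

/-- Type `I/F`: `C` is infinite and all its foils are finite. -/
def TypeIF (N : Set α) (H : α → α) (C : Set α) : Prop :=
  C.Infinite ∧ ∀ L ∈ foilsIn N H C, L.Finite

/-- A bi-infinite path in `C`. -/
def IsBiInfinitePath (H : α → α) (C : Set α) (p : ℤ → α) : Prop :=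
  ∀ n, p n ∈ C ∧ H (p n) = p (n + 1)

/-- The trichotomy asserted for a component `C` by the cardinality classification:
* type `F/F`: `C` is finite, has a unique cycle, whose length is the number of foils of `C`, and
  the primeval points of `C` are those of this cycle;
* type `I/F`: `C` is acyclic, each of its foils has a junior foil, and the primeval points of `C`
  form the unique bi-infinite path of `C`;
* type `I/I`: `C` is acyclic and has no primeval points. -/
def Classified (N : Set α) (H : α → α) (C : Set α) : Prop :=
  (C.Finite ∧ ∃ K ⊆ C, IsCycle H (foilsIn N H C).ncard K ∧
      (∀ n K', IsCycle H n K' → K' ⊆ C → K' = K) ∧ primeval N H ∩ C = K) ∨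
  (TypeIF N H C ∧ Acyclic H C ∧ (∀ L ∈ foilsIn N H C, ∃ y ∈ N, H y ∈ L) ∧
      ∃ p : ℤ → α, IsBiInfinitePath H C p ∧ primeval N H ∩ C = Set.range p ∧
        ∀ q : ℤ → α, IsBiInfinitePath H C q → ∃ k : ℤ, ∀ n, q n = p (n + k)) ∨
  (TypeII N H C ∧ Acyclic H C ∧ primeval N H ∩ C = ∅)

end PointShift

/-! Write `Λ` for `λμ`. Two computations with `a⁻² da db` carry the proof. First, the part of the
half-plane to the right of `t` and of height `h` has measure `h / t`, so every strip `S(X)` has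
intensity exactly `2δλ < 1`, wherever `X` lies. Chains in which each point lies in the strip of the
previous one and strictly to its right are therefore dominated by a subcritical branching process:
chains of `n` steps starting in a bounded window exist with probability at most a constant times `r
^ n`, for any `r` in `(2δλ, 1)`. A non-stationary orbit of `H` would be such a chain of every
length, so almost surely every orbit reaches a fixed point (`ae_exists_not_strictChain`).

Second, the cone `|x.b - y.b| ≤ δ x.a` has infinite measure near `a = 0`, so it contains points of
the process arbitrarily close to the boundary, for every point `y` of the process
(`ae_exists_mem_cone`). If `y` is fixed and `x` is such a point with `x.a < y.a / 2`, then `y ∈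
S(x)`, and the part of `S(x)` to the right of `y` lies in `S(y)`, so `H x = y`
(`eq_fixedPt_of_mem_cone`). Hence fixed points have infinitely many preimages.

The rest is deterministic: when all orbits end in fixed points, the points of a component share one
terminal point and thus one foil. Each component is then an infinite foil containing a cycle of
length one, which every class of the classification forbids. -/

namespace AxB

/-! ### The measure `a⁻² da db` as a product, its Haar property, and failure of right invariance -/

/-- The measure `a⁻² da` on the positive half-line. -/
noncomputable def dilationMeasure : Measure ℝ :=
  (volume.restrict (Set.Ioi 0)).withDensity fun a => ENNReal.ofReal (1 / a ^ 2)

theorem measurable_density : Measurable fun a : ℝ => ENNReal.ofReal (1 / a ^ 2) := by fun_prop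

/-- The coordinates of a point, in the plane. -/
def coords (x : AxB) : ℝ × ℝ := (x.a, x.b)

theorem measurableEmbedding_coords : MeasurableEmbedding coords :=
  MeasurableEmbedding.subtype_coe (s := {p : ℝ × ℝ | 0 < p.1})
    (measurableSet_lt measurable_const measurable_fst)

theorem measurable_a : Measurable a := measurable_fst.comp measurable_subtype_coe

theorem measurable_b : Measurable b := measurable_snd.comp measurable_subtype_coe

instance : MeasurableSingletonClass AxB :=
  inferInstanceAs (MeasurableSingletonClass {p : ℝ × ℝ // 0 < p.1})

instance : SFinite dilationMeasure := by unfold dilationMeasure; infer_instance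

theorem haar_eq_comap_prod : haar = Measure.comap coords (dilationMeasure.prod volume) := by
  change Measure.comap coords (volume.withDensity _) = _
  unfold dilationMeasure
  ext s hs
  rw [measurableEmbedding_coords.comap_apply, measurableEmbedding_coords.comap_apply,
    prod_withDensity_left measurable_density]
  have hs' := measurableEmbedding_coords.measurableSet_image.2 hs
  have h1 : (volume.restrict (Set.Ioi (0 : ℝ))).prod (volume : Measure ℝ)
      = (volume : Measure (ℝ × ℝ)).restrict (Set.Ioi 0 ×ˢ Set.univ) := by
    rw [Measure.volume_eq_prod, ← Measure.prod_restrict, Measure.restrict_univ]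
  rw [h1, withDensity_apply _ hs', withDensity_apply _ hs', Measure.restrict_restrict hs']
  congr 2
  symm
  apply Set.inter_eq_left.2
  rintro _ ⟨x, -, rfl⟩
  exact ⟨x.2, trivial⟩

theorem haar_prod {s t : Set ℝ} :
    haar {x | x.a ∈ s ∧ x.b ∈ t} = dilationMeasure (s ∩ Set.Ioi 0) * volume t := by
  rw [haar_eq_comap_prod, measurableEmbedding_coords.comap_apply, ← Measure.prod_prod]
  congr 1
  ext ⟨p, q⟩
  constructor
  · rintro ⟨x, ⟨h1, h2⟩, h⟩
    cases h
    exact ⟨⟨h1, x.a_pos⟩, h2⟩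
  · rintro ⟨⟨h1, h2⟩, h3⟩
    exact ⟨⟨(p, q), h2⟩, ⟨h1, h3⟩, rfl⟩

theorem dilationMeasure_le {s : Set ℝ} {t : ℝ} (hs : MeasurableSet s) (ht : 0 < t)
    (h : s ⊆ Set.Ici t) : dilationMeasure s ≤ ENNReal.ofReal (1 / t ^ 2) * volume s := by
  unfold dilationMeasure
  rw [withDensity_apply _ hs, ← setLIntegral_const]
  calc _ ≤ ∫⁻ a in s, ENNReal.ofReal (1 / a ^ 2) :=
        lintegral_mono' (Measure.restrict_mono le_rfl Measure.restrict_le_self) le_rfl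
    _ ≤ _ := by
        apply setLIntegral_mono measurable_const
        intro x hx
        have := h hx
        simp only [Set.mem_Ici] at this
        gcongr

theorem dilationMeasure_Ici {t : ℝ} (ht : 0 < t) :
    dilationMeasure (Set.Ici t) = ENNReal.ofReal (1 / t) := by
  have h0 : ∀ x ∈ Set.Ioi t, x ^ (-2 : ℝ) = 1 / x ^ 2 := fun x hx => by
    rw [Real.rpow_neg (ht.trans hx).le]; norm_num
  unfold dilationMeasure
  rw [withDensity_apply _ measurableSet_Ici, Measure.restrict_restrict measurableSet_Ici,
    Set.inter_eq_left.2 (Set.Ici_subset_Ioi.2 ht), setLIntegral_congr Ioi_ae_eq_Ici.symm,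
    ← ofReal_integral_eq_lintegral_ofReal]
  · congr 1
    rw [← setIntegral_congr_fun measurableSet_Ioi h0, integral_Ioi_rpow_of_lt (by norm_num) ht]
    norm_num [Real.rpow_neg_one]
  · exact (integrableOn_Ioi_rpow_of_lt (by norm_num) ht).congr_fun h0 measurableSet_Ioi
  · exact Filter.Eventually.of_forall fun x => by positivity

theorem dilationMeasure_Ico {s t : ℝ} (hs : 0 < s) (hst : s ≤ t) :
    dilationMeasure (Set.Ico s t) = ENNReal.ofReal (1 / s - 1 / t) := by
  have ht := hs.trans_le hst
  rw [← Set.Ici_sdiff_Ici, measure_sdiff (Set.Ici_subset_Ici.2 hst)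
    measurableSet_Ici.nullMeasurableSet (by simp [dilationMeasure_Ici ht]),
    dilationMeasure_Ici hs, dilationMeasure_Ici ht, ENNReal.ofReal_sub _ (by positivity)]

theorem haar_Ici_Icc {t u v : ℝ} (ht : 0 < t) :
    haar {x | t ≤ x.a ∧ u ≤ x.b ∧ x.b ≤ v} = ENNReal.ofReal ((v - u) / t) := by
  have := haar_prod (s := Set.Ici t) (t := Set.Icc u v)
  rw [Set.inter_eq_left.2 (Set.Ici_subset_Ioi.2 ht), dilationMeasure_Ici ht,
    Real.volume_Icc, ← ENNReal.ofReal_mul (by positivity)] at this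
  rw [div_eq_inv_mul, ← one_div]
  exact this

theorem haar_Ico_Icc {s t u v : ℝ} (hs : 0 < s) (hst : s ≤ t) :
    haar {x | (s ≤ x.a ∧ x.a < t) ∧ u ≤ x.b ∧ x.b ≤ v}
      = ENNReal.ofReal ((1 / s - 1 / t) * (v - u)) := by
  have := haar_prod (s := Set.Ico s t) (t := Set.Icc u v)
  rw [Set.inter_eq_left.2 (Set.Ico_subset_Ici_self.trans (Set.Ici_subset_Ioi.2 hs)), dilationMeasure_Ico hs hst,
    Real.volume_Icc, ← ENNReal.ofReal_mul
      (sub_nonneg.2 (one_div_le_one_div_of_le hs hst))] at this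
  exact this

theorem map_mul_dilationMeasure {c : ℝ} (hc : 0 < c) :
    dilationMeasure.map (c * ·) = ENNReal.ofReal c • dilationMeasure := by
  have key : ∀ s, MeasurableSet s → dilationMeasure s = ∫⁻ x, (s ∩ Set.Ioi 0).indicator
      (fun a : ℝ => ENNReal.ofReal (1 / a ^ 2)) x := fun s hs => by
    rw [lintegral_indicator (hs.inter measurableSet_Ioi), dilationMeasure,
      withDensity_apply _ hs, Measure.restrict_restrict hs]
  ext s hs
  rw [Measure.map_apply (measurable_const_mul c) hs, Measure.smul_apply,
    key _ (measurable_const_mul c hs), key _ hs, smul_eq_mul]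
  have hm : Measurable ((s ∩ Set.Ioi 0).indicator
      (fun a : ℝ => ENNReal.ofReal (1 / a ^ 2))) :=
    measurable_density.indicator (hs.inter measurableSet_Ioi)
  have h2 := lintegral_map (μ := volume) hm (measurable_const_mul c)
  rw [Real.map_volume_mul_left hc.ne', lintegral_smul_measure, smul_eq_mul,
    abs_of_pos (inv_pos.2 hc)] at h2
  have h3 : ∀ x : ℝ, ((c * ·) ⁻¹' s ∩ Set.Ioi 0).indicator
        (fun a : ℝ => ENNReal.ofReal (1 / a ^ 2)) x = ENNReal.ofReal (c ^ 2) *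
        (s ∩ Set.Ioi 0).indicator (fun a : ℝ => ENNReal.ofReal (1 / a ^ 2)) (c * x) := by
    intro x
    by_cases hx : c * x ∈ s ∩ Set.Ioi 0
    · have hx' : x ∈ (c * ·) ⁻¹' s ∩ Set.Ioi 0 := ⟨hx.1, (mul_pos_iff_of_pos_left hc).1 hx.2⟩
      rw [Set.indicator_of_mem hx, Set.indicator_of_mem hx',
        ← ENNReal.ofReal_mul (by positivity)]
      congr 1
      have : x ≠ 0 := hx'.2.ne'
      field_simp
    · have hx' : x ∉ (c * ·) ⁻¹' s ∩ Set.Ioi 0 := fun h => hx ⟨h.1, mul_pos hc h.2⟩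
      rw [Set.indicator_of_notMem hx, Set.indicator_of_notMem hx', mul_zero]
  simp_rw [h3]
  rw [lintegral_const_mul' _ _ ENNReal.ofReal_ne_top, ← h2, ← mul_assoc,
    ← ENNReal.ofReal_mul (by positivity)]
  congr 2
  field_simp

/-- Left multiplication by `g` acts separately on the coordinates: `a ↦ g.a * a` scales `a⁻² da` by
`g.a`, and the affine map on `b` scales Lebesgue measure by `g.a⁻¹`. The factors cancel. -/
theorem haar_isMulLeftInvariant : haar.IsMulLeftInvariant := by
  refine ⟨fun g => ?_⟩
  have hg := g.a_pos
  have hmul : Measurable (g * · : AxB → AxB) :=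
    Measurable.subtype_mk (f := fun x : AxB => (g.a * x.a, g.a * x.b + g.b))
      (by have := measurable_a; have := measurable_b; fun_prop)
  have h1 : dilationMeasure.map (g.a * ·) = ENNReal.ofReal g.a • dilationMeasure :=
    map_mul_dilationMeasure hg
  have h2 : (volume : Measure ℝ).map (g.a * · + g.b)
      = ENNReal.ofReal (g.a⁻¹) • (volume : Measure ℝ) := by
    have : (fun x : ℝ => g.a * x + g.b) = (· + g.b) ∘ (g.a * ·) := rfl
    rw [this, ← Measure.map_map (by fun_prop) (by fun_prop), Real.map_volume_mul_left hg.ne',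
      Measure.map_smul, map_add_right_eq_self, abs_of_pos (inv_pos.2 hg)]
  have h3 : (dilationMeasure.prod (volume : Measure ℝ)).map
      (Prod.map (g.a * ·) (g.a * · + g.b)) = dilationMeasure.prod volume := by
    rw [← Measure.map_prod_map _ _ (by fun_prop) (by fun_prop), h1, h2, Measure.prod_smul_left,
      Measure.prod_smul_right, smul_smul, ← ENNReal.ofReal_mul hg.le, mul_inv_cancel₀ hg.ne']
    simp
  ext s hs
  rw [Measure.map_apply hmul hs, haar_eq_comap_prod, measurableEmbedding_coords.comap_apply,
    measurableEmbedding_coords.comap_apply]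
  conv_rhs => rw [← h3, Measure.map_apply (by fun_prop)
    (measurableEmbedding_coords.measurableSet_image.2 hs)]
  congr 1
  ext ⟨p, q⟩
  constructor
  · rintro ⟨x, hx, h⟩
    refine ⟨g * x, hx, ?_⟩
    have h1 : x.a = p := congrArg Prod.fst h
    have h2 : x.b = q := congrArg Prod.snd h
    simp only [Prod.map_apply, ← h1, ← h2]
    rfl
  · rintro ⟨y, hy, h⟩
    have h1 : y.a = g.a * p := congrArg Prod.fst h
    have h2 : y.b = g.a * q + g.b := congrArg Prod.snd h
    have hp : 0 < p := (mul_pos_iff_of_pos_left hg).1 (h1 ▸ y.a_pos)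
    let x : AxB := ⟨(p, q), hp⟩
    have : g * x = y := ext h1.symm h2.symm
    refine ⟨x, ?_, rfl⟩
    rwa [Set.mem_preimage, this]

/-- A compact set lies in a horizontal half-strip bounded away from `a = 0`, which has finite
measure although it is unbounded. A nonempty open set contains a small box of positive measure. -/
theorem haar_isHaarMeasure : haar.IsHaarMeasure where
  toIsMulLeftInvariant := haar_isMulLeftInvariant
  lt_top_of_isCompact := by
    intro K hK
    rcases K.eq_empty_or_nonempty with rfl | hne
    · simp
    have hca : Continuous a := continuous_fst.comp continuous_subtype_val
    have hcb : Continuous b := continuous_snd.comp continuous_subtype_val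
    obtain ⟨x, -, hx⟩ := hK.exists_isMinOn hne hca.continuousOn
    obtain ⟨y, -, hy⟩ := hK.exists_isMinOn hne hcb.continuousOn
    obtain ⟨z, -, hz⟩ := hK.exists_isMaxOn hne hcb.continuousOn
    refine (measure_mono fun w hw => ?_).trans_lt
      ((haar_Ici_Icc (u := y.b) (v := z.b) x.a_pos).trans_lt ENNReal.ofReal_lt_top)
    exact ⟨hx hw, hy hw, hz hw⟩
  open_pos := by
    rintro U hU ⟨x, hx⟩ h0
    obtain ⟨V, hV, hVU⟩ := hU
    have hxV : (x.a, x.b) ∈ V ∩ {p : ℝ × ℝ | 0 < p.1} := by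
      subst hVU
      exact ⟨hx, x.a_pos⟩
    have hV' : IsOpen (V ∩ {p : ℝ × ℝ | 0 < p.1}) :=
      hV.inter (isOpen_lt continuous_const continuous_fst)
    obtain ⟨ε, hε, hball⟩ := Metric.isOpen_iff.1 hV' _ hxV
    have hsub : {y : AxB | (x.a ≤ y.a ∧ y.a < x.a + ε / 2) ∧ x.b ≤ y.b ∧ y.b ≤ x.b + ε / 2} ⊆ U := by
      rintro y ⟨⟨h1, h2⟩, h3, h4⟩
      have : (y.a, y.b) ∈ V := by
        refine (hball ?_).1
        rw [Metric.mem_ball, Prod.dist_eq, max_lt_iff, Real.dist_eq, Real.dist_eq, abs_lt, abs_lt]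
        refine ⟨⟨?_, ?_⟩, ?_, ?_⟩ <;> linarith
      rw [← hVU]
      exact this
    have := measure_mono_null hsub h0
    have hxa := x.a_pos
    rw [haar_Ico_Icc hxa (by linarith), ENNReal.ofReal_eq_zero] at this
    have h1 : 1 / (x.a + ε / 2) < 1 / x.a := one_div_lt_one_div_of_lt hxa (by linarith)
    have h2 : 0 < (1 / x.a - 1 / (x.a + ε / 2)) * (x.b + ε / 2 - x.b) :=
      mul_pos (by linarith) (by linarith)
    linarith

theorem haar_not_isMulRightInvariant : ¬ haar.IsMulRightInvariant := by
  intro h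
  -- Right multiplication by `(2, 0)` doubles `a` and keeps `b`, so the half-strip `a ≥ 2` pulls
  -- back to `a ≥ 1`, which has twice its measure.
  let g : AxB := ⟨(2, 0), two_pos⟩
  have hmul : Measurable (· * g : AxB → AxB) :=
    Measurable.subtype_mk (f := fun x : AxB => (x.a * g.a, x.a * g.b + x.b))
      (by have := measurable_a; have := measurable_b; fun_prop)
  have hS : MeasurableSet {x : AxB | 2 ≤ x.a ∧ 0 ≤ x.b ∧ x.b ≤ 1} := by
    have := measurable_a; have := measurable_b
    measurability
  have h1 := h.map_mul_right_eq_self g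
  have h2 := congrArg (fun ν => ν {x : AxB | 2 ≤ x.a ∧ 0 ≤ x.b ∧ x.b ≤ 1}) h1
  rw [Measure.map_apply hmul hS] at h2
  have h3 : (· * g) ⁻¹' {x : AxB | 2 ≤ x.a ∧ 0 ≤ x.b ∧ x.b ≤ 1}
      = {x : AxB | 1 ≤ x.a ∧ 0 ≤ x.b ∧ x.b ≤ 1} := by
    have ga : g.a = 2 := rfl
    have gb : g.b = 0 := rfl
    ext x
    simp only [Set.mem_preimage, Set.mem_ofPred_eq, mul_a, mul_b, ga, gb, mul_zero, zero_add]
    constructor <;> rintro ⟨h, h', h''⟩ <;> exact ⟨by linarith, h', h''⟩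
  rw [h3, haar_Ici_Icc one_pos, haar_Ici_Icc two_pos,
    ENNReal.ofReal_eq_ofReal_iff (by norm_num) (by norm_num)] at h2
  norm_num at h2

end AxB

/-! ### Counting measures and first-moment bounds for Poisson processes -/

section PointProcess

variable {Ω α : Type*} [MeasurableSpace Ω] [TopologicalSpace α] [MeasurableSpace α]

namespace IsPointProcess

variable {m : Ω → Measure α}

theorem measurable_apply (h : IsPointProcess m) {B : Set α} (hB : MeasurableSet B) :
    Measurable fun ω => m ω B :=
  (Measure.measurable_coe hB).comp h.measurable

theorem one_le_measure_singleton [MeasurableSingletonClass α] (h : IsPointProcess m) {ω : Ω}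
    {x : α} (hx : x ∈ pointsOf (m ω)) : 1 ≤ m ω {x} := by
  obtain ⟨ι, hι, y, hy⟩ := h.counting ω
  have hx' : m ω {x} ≠ 0 := hx
  rw [hy, Measure.sum_apply _ (measurableSet_singleton x)] at hx' ⊢
  obtain ⟨i, hi⟩ := not_forall.1 (mt ENNReal.tsum_eq_zero.2 hx')
  refine le_trans ?_ (ENNReal.le_tsum i)
  rw [Measure.dirac_apply' _ (measurableSet_singleton x)] at hi ⊢
  simp only [Set.indicator_apply_ne_zero] at hi
  simp [Set.indicator_of_mem hi.1]

theorem measure_ne_zero_iff [MeasurableSingletonClass α] (h : IsPointProcess m) {ω : Ω}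
    {B : Set α} (hB : MeasurableSet B) : m ω B ≠ 0 ↔ (pointsOf (m ω) ∩ B).Nonempty := by
  constructor
  · intro h0
    obtain ⟨ι, hι, y, hy⟩ := h.counting ω
    rw [hy, Measure.sum_apply _ hB] at h0
    obtain ⟨i, hi⟩ := not_forall.1 (mt ENNReal.tsum_eq_zero.2 h0)
    rw [Measure.dirac_apply' _ hB] at hi
    simp only [Set.indicator_apply_ne_zero] at hi
    refine ⟨y i, ?_, hi.1⟩
    change m ω {y i} ≠ 0
    rw [hy, Measure.sum_apply _ (measurableSet_singleton _)]
    refine fun h1 => one_ne_zero (α := ℝ≥0∞) ?_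
    have := ENNReal.tsum_eq_zero.1 h1 i
    rwa [Measure.dirac_apply' _ (measurableSet_singleton _), Set.indicator_of_mem (Set.mem_singleton _)] at this
  · rintro ⟨x, hx, hxB⟩ h0
    exact hx (measure_mono_null (Set.singleton_subset_iff.2 hxB) h0)

theorem card_le_measure [MeasurableSingletonClass α] (h : IsPointProcess m) {ω : Ω}
    {B : Set α} {F : Finset α} (hF : (F : Set α) ⊆ pointsOf (m ω) ∩ B) :
    (F.card : ℝ≥0∞) ≤ m ω B := by
  calc (F.card : ℝ≥0∞) = ∑ x ∈ F, 1 := by simp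
    _ ≤ ∑ x ∈ F, m ω {x} := Finset.sum_le_sum fun x hx => h.one_le_measure_singleton (hF hx).1
    _ = m ω F := sum_measure_singleton
    _ ≤ m ω B := measure_mono fun x hx => (hF hx).2

theorem finite_inter [MeasurableSingletonClass α] (h : IsPointProcess m) {ω : Ω}
    {B : Set α} (hB : m ω B < ∞) : (pointsOf (m ω) ∩ B).Finite := by
  by_contra hinf
  obtain ⟨n, hn⟩ := ENNReal.exists_nat_gt hB.ne
  obtain ⟨F, hF, hc⟩ := Set.Infinite.exists_subset_card_eq hinf n
  have := h.card_le_measure hF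
  rw [hc] at this
  exact (lt_irrefl _ (hn.trans_le this))

end IsPointProcess

namespace IsPoissonProcess

variable {P : Measure Ω} {m : Ω → Measure α} {Λ : Measure α}

theorem measure_mem (h : IsPoissonProcess P m Λ) {B : Set α} (hB : MeasurableSet B)
    (hΛ : Λ B ≠ ∞) {s : Set ℝ≥0∞} (hs : MeasurableSet s) :
    P {ω | m ω B ∈ s} = poissonMeasure (Λ B).toNNReal {k : ℕ | (k : ℝ≥0∞) ∈ s} := by
  have h1 := congrArg (fun ν => ν s) (h.poisson B hB hΛ)
  rwa [Measure.map_apply (h.measurable_apply hB) hs,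
    Measure.map_apply (by fun_prop) hs] at h1

theorem measure_eq_zero (h : IsPoissonProcess P m Λ) {B : Set α} (hB : MeasurableSet B)
    (hΛ : Λ B ≠ ∞) : P {ω | m ω B = 0} = ENNReal.ofReal (Real.exp (-(Λ B).toReal)) := by
  have h1 := h.measure_mem hB hΛ (measurableSet_singleton 0)
  have h2 : {k : ℕ | (k : ℝ≥0∞) ∈ ({0} : Set ℝ≥0∞)} = {0} := by ext; simp
  rw [h2, poissonMeasure_singleton] at h1
  simpa [ENNReal.coe_toNNReal_eq_toReal] using h1

theorem ae_lt_top [IsProbabilityMeasure P] (h : IsPoissonProcess P m Λ) {B : Set α}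
    (hB : MeasurableSet B) (hΛ : Λ B ≠ ∞) : ∀ᵐ ω ∂P, m ω B < ∞ := by
  have h1 := h.measure_mem hB hΛ (measurableSet_singleton ∞)
  have h2 : {k : ℕ | (k : ℝ≥0∞) ∈ ({∞} : Set ℝ≥0∞)} = ∅ := by ext; simp
  rw [h2, measure_empty] at h1
  rw [ae_iff]
  simpa using h1

theorem measure_ne_zero_le [IsProbabilityMeasure P] (h : IsPoissonProcess P m Λ) {B : Set α}
    (hB : MeasurableSet B) : P {ω | m ω B ≠ 0} ≤ Λ B := by
  by_cases hΛ : Λ B = ∞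
  · simp [hΛ]
  have hm : MeasurableSet {ω | m ω B = 0} := h.measurable_apply hB (measurableSet_singleton 0)
  have : {ω | m ω B ≠ 0} = {ω | m ω B = 0}ᶜ := rfl
  rw [this, prob_compl_eq_one_sub hm, h.measure_eq_zero hB hΛ, ← ENNReal.ofReal_one,
    ← ENNReal.ofReal_sub _ (Real.exp_nonneg _)]
  refine ENNReal.ofReal_le_of_le_toReal ?_
  -- This is `1 - exp (-x) ≤ x`.
  linarith [Real.add_one_le_exp (-(Λ B).toReal)]

theorem measure_two_le [IsProbabilityMeasure P] (h : IsPoissonProcess P m Λ) {B : Set α}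
    (hB : MeasurableSet B) : P {ω | 2 ≤ m ω B} ≤ Λ B ^ 2 := by
  by_cases hΛ : Λ B = ∞
  · simp [hΛ]
  have h1 := h.measure_mem hB hΛ (measurableSet_Ici (a := 2))
  have h2 : {k : ℕ | (k : ℝ≥0∞) ∈ Set.Ici 2} = {0, 1}ᶜ := by
    ext k
    simp only [Set.mem_Ici, Set.mem_ofPred_eq, Set.mem_compl_iff, Set.mem_insert_iff,
      Set.mem_singleton_iff]
    norm_cast
    omega
  rw [h2, prob_compl_eq_one_sub (.of_discrete), Set.insert_eq,
    measure_union (by simp) (measurableSet_singleton _), poissonMeasure_singleton,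
    poissonMeasure_singleton] at h1
  change P {ω | 2 ≤ m ω B} = _ at h1
  rw [h1]
  have h3 : ((Λ B).toNNReal : ℝ) = (Λ B).toReal := rfl
  simp only [h3, pow_zero, pow_one, Nat.factorial, mul_one, Nat.cast_one, div_one]
  set x := (Λ B).toReal
  have hx : 0 ≤ x := ENNReal.toReal_nonneg
  rw [← ENNReal.ofReal_add (Real.exp_nonneg _) (by positivity), ← ENNReal.ofReal_one,
    ← ENNReal.ofReal_sub _ (by positivity)]
  refine ENNReal.ofReal_le_of_le_toReal ?_
  rw [ENNReal.toReal_pow]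
  -- Since `exp (-x) ≥ 1 - x`, one has `1 - (1 + x) exp (-x) ≤ 1 - (1 + x)(1 - x) = x ^ 2`.
  nlinarith [Real.add_one_le_exp (-x)]

/-- Stands in for a multivariate moment formula: by independence, the probability that several
disjoint cells are all occupied is at most the product of their intensities. A list is used because
chains are built by prepending cells. -/
theorem measure_forall_ne_zero_le [IsProbabilityMeasure P] (h : IsPoissonProcess P m Λ)
    (L : List (Set α)) (hL : ∀ B ∈ L, MeasurableSet B) (hd : L.Pairwise Disjoint) :
    P {ω | ∀ B ∈ L, m ω B ≠ 0} ≤ (L.map Λ).prod := by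
  have hind := h.indep L.length L.get (fun i => hL _ (L.get_mem i)) (by
    intro i j hij
    rcases lt_or_gt_of_ne hij with h | h
    · exact List.pairwise_iff_get.1 hd _ _ h
    · exact (List.pairwise_iff_get.1 hd _ _ h).symm)
  have h1 := hind.measure_inter_preimage_eq_mul Finset.univ (sets := fun _ => {0}ᶜ)
    (fun i _ => (measurableSet_singleton _).compl)
  have h2 : {ω | ∀ B ∈ L, m ω B ≠ 0}
      = ⋂ i ∈ Finset.univ, (fun ω => m ω (L.get i)) ⁻¹' {0}ᶜ := by
    ext ω
    simp only [Set.mem_ofPred_eq, List.forall_mem_iff_get, Set.mem_iInter, Finset.mem_univ,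
      forall_true_left]
    rfl
  rw [h2, h1]
  calc _ ≤ ∏ i : Fin L.length, Λ (L.get i) :=
        Finset.prod_le_prod' fun i _ => h.measure_ne_zero_le (hL _ (L.get_mem i))
    _ = (L.map Λ).prod := by
        rw [← List.prod_ofFn]
        conv_rhs => rw [← List.ofFn_get L, List.map_ofFn]
        rfl

theorem measure_ne_zero_inter_eq_zero_le [IsProbabilityMeasure P] (h : IsPoissonProcess P m Λ)
    {A B : Set α} (hA : MeasurableSet A) (hB : MeasurableSet B) (hd : Disjoint A B)
    (hΛ : Λ B ≠ ∞) :
    P {ω | m ω A ≠ 0 ∧ m ω B = 0} ≤ Λ A * ENNReal.ofReal (Real.exp (-(Λ B).toReal)) := by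
  have hind := (h.indep 2 ![A, B] (by simp [Fin.forall_fin_two, hA, hB]) (by
    intro i j hij
    fin_cases i <;> fin_cases j <;> simp_all [disjoint_comm])).indepFun
      (show (0 : Fin 2) ≠ 1 by decide)
  have h1 := hind.measure_inter_preimage_eq_mul {0}ᶜ {0} (measurableSet_singleton _).compl
    (measurableSet_singleton _)
  simp only [Matrix.cons_val_zero, Matrix.cons_val_one] at h1
  calc _ = _ := h1
    _ ≤ _ := mul_le_mul' (h.measure_ne_zero_le hA) (h.measure_eq_zero hB hΛ).le

end IsPoissonProcess

end PointProcess

theorem tsum_measure_inter_preimage_singleton {α ι : Type*} [MeasurableSpace α]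
    [MeasurableSpace ι] [MeasurableSingletonClass ι] [Countable ι] (μ : Measure α) {f : α → ι}
    (hf : Measurable f) {W : Set α} (hW : MeasurableSet W) :
    ∑' i, μ (W ∩ f ⁻¹' {i}) = μ W := by
  rw [← measure_iUnion]
  · congr 1
    ext x
    simp
  · intro i j hij
    exact Set.disjoint_left.2 fun x hx hx' => hij (hx.2.symm.trans hx'.2)
  · exact fun i => hW.inter (hf (measurableSet_singleton i))

/-! ### Bounded windows and intensities of rectangles -/

namespace AxB

/-- Bounded windows, exhausting the half-plane up to the horizontal infinity. -/
def window (T : ℕ) : Set AxB := {x | 1 / ((T : ℝ) + 1) ≤ x.a ∧ -(T : ℝ) ≤ x.b ∧ x.b ≤ T}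

theorem measurableSet_Ici_Icc (t u v : ℝ) :
    MeasurableSet {x : AxB | t ≤ x.a ∧ u ≤ x.b ∧ x.b ≤ v} :=
  (measurableSet_le measurable_const measurable_a).inter
    ((measurableSet_le measurable_const measurable_b).inter
      (measurableSet_le measurable_b measurable_const))

theorem measurableSet_Ico_Icc (s t u v : ℝ) :
    MeasurableSet {x : AxB | (s ≤ x.a ∧ x.a < t) ∧ u ≤ x.b ∧ x.b ≤ v} :=
  ((measurableSet_le measurable_const measurable_a).inter
    (measurableSet_lt measurable_a measurable_const)).inter
    ((measurableSet_le measurable_const measurable_b).inter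
      (measurableSet_le measurable_b measurable_const))

theorem measurableSet_window (T : ℕ) : MeasurableSet (window T) := measurableSet_Ici_Icc _ _ _

theorem exists_mem_window (x : AxB) (K : ℝ) :
    ∃ T : ℕ, 1 / ((T : ℝ) + 1) ≤ x.a ∧ |x.b| + K ≤ T := by
  obtain ⟨T, hT⟩ := exists_nat_gt (max (1 / x.a) (|x.b| + K))
  have h1 := (le_max_left _ _).trans_lt hT
  have h2 := (le_max_right _ _).trans_lt hT
  refine ⟨T, ?_, h2.le⟩
  rw [div_le_comm₀ (by positivity) x.a_pos]
  linarith

theorem exists_strip_subset_window {δ : ℝ} (x : AxB) :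
    ∃ T : ℕ, strip δ x ⊆ window T := by
  obtain ⟨T, h1, h2⟩ := exists_mem_window x (δ * x.a)
  refine ⟨T, fun y hy => ⟨h1.trans hy.1, ?_, ?_⟩⟩
  · linarith [hy.2.1, neg_abs_le x.b]
  · linarith [hy.2.2, le_abs_self x.b]

theorem mem_strip_self {δ : ℝ} (hδ : 0 < δ) (x : AxB) : x ∈ strip δ x := by
  have := mul_pos hδ x.a_pos
  exact ⟨le_rfl, by linarith, by linarith⟩

theorem exists_window {δ : ℝ} (hδ : 0 < δ) (x : AxB) : ∃ T : ℕ, x ∈ window T :=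
  (exists_strip_subset_window x).imp fun _ hT => hT (mem_strip_self hδ x)

section Intensity

variable {lam : ℝ}

theorem intensity_Ici_Icc {t u v : ℝ} (hlam : 0 < lam) (ht : 0 < t) :
    (ENNReal.ofReal lam • haar) {x | t ≤ x.a ∧ u ≤ x.b ∧ x.b ≤ v}
      = ENNReal.ofReal (lam * ((v - u) / t)) := by
  rw [Measure.smul_apply, haar_Ici_Icc ht, smul_eq_mul, ENNReal.ofReal_mul hlam.le]

theorem intensity_Ico_Icc {s t u v : ℝ} (hlam : 0 < lam) (hs : 0 < s) (hst : s ≤ t) :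
    (ENNReal.ofReal lam • haar) {x | (s ≤ x.a ∧ x.a < t) ∧ u ≤ x.b ∧ x.b ≤ v}
      = ENNReal.ofReal (lam * ((1 / s - 1 / t) * (v - u))) := by
  rw [Measure.smul_apply, haar_Ico_Icc hs hst, smul_eq_mul, ENNReal.ofReal_mul hlam.le]

theorem intensity_window_ne_top (hlam : 0 < lam) (T : ℕ) :
    (ENNReal.ofReal lam • haar) (window T) ≠ ∞ := by
  unfold window
  rw [intensity_Ici_Icc hlam (by positivity)]
  exact ENNReal.ofReal_ne_top

theorem intensity_window_slab_le (T : ℕ) {s : ℝ} (hs : 0 < s) (i : ℤ) :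
    (ENNReal.ofReal lam • haar) (window T ∩ (fun x => ⌊x.a * s⌋) ⁻¹' {i})
      ≤ ENNReal.ofReal lam * (ENNReal.ofReal (1 / (1 / ((T : ℝ) + 1)) ^ 2) *
        ENNReal.ofReal (1 / s) * ENNReal.ofReal (2 * T)) := by
  rw [Measure.smul_apply, smul_eq_mul]
  gcongr
  have hsub : window T ∩ (fun x => ⌊x.a * s⌋) ⁻¹' {i} ⊆
      {x | x.a ∈ Set.Ici (1 / ((T : ℝ) + 1)) ∩ Set.Ico (i / s) ((i + 1) / s) ∧
        x.b ∈ Set.Icc (-(T : ℝ)) T} := by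
    rintro x ⟨⟨h1, h2⟩, h3⟩
    obtain ⟨h4, h5⟩ := Int.floor_eq_iff.1 (Set.mem_singleton_iff.1 h3)
    exact ⟨⟨h1, (div_le_iff₀ hs).2 h4, (lt_div_iff₀ hs).2 h5⟩, h2⟩
  refine (measure_mono hsub).trans ?_
  rw [haar_prod, Real.volume_Icc]
  have h1 : (T : ℝ) - -T = 2 * T := by ring
  rw [h1]
  gcongr
  refine (measure_mono Set.inter_subset_left).trans ?_
  refine (dilationMeasure_le (measurableSet_Ici.inter measurableSet_Ico)
    (t := 1 / ((T : ℝ) + 1)) (by positivity) Set.inter_subset_left).trans ?_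
  gcongr
  refine (measure_mono Set.inter_subset_right).trans ?_
  rw [Real.volume_Ico]
  apply le_of_eq
  congr 1
  ring

end Intensity

/-! ### Almost sure nonemptiness, finiteness of strips, and absence of ties -/

theorem ae_nonempty {Ω : Type*} [MeasurableSpace Ω] {P : Measure Ω}
    {m : Ω → Measure AxB} {lam : ℝ} (hlam : 0 < lam)
    (hm : IsPoissonProcess P m (ENNReal.ofReal lam • haar)) :
    ∀ᵐ ω ∂P, (pointsOf (m ω)).Nonempty := by
  rw [ae_iff]
  have h1 : ∀ n : ℕ, P {ω | ¬ (pointsOf (m ω)).Nonempty} ≤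
      ENNReal.ofReal (Real.exp (-(lam * n))) := by
    intro n
    have hB := measurableSet_Ici_Icc 1 0 n
    have hΛ := intensity_Ici_Icc (u := 0) (v := n) hlam one_pos
    have h2 := hm.measure_eq_zero hB (by rw [hΛ]; exact ENNReal.ofReal_ne_top)
    rw [hΛ, ENNReal.toReal_ofReal (by simp; positivity)] at h2
    simp only [sub_zero, div_one] at h2
    rw [← h2]
    refine measure_mono fun ω hω => ?_
    by_contra h3
    exact hω (((hm.measure_ne_zero_iff hB).1 h3).mono Set.inter_subset_left)
  have h2 : Filter.Tendsto (fun n : ℕ => ENNReal.ofReal (Real.exp (-(lam * n))))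
      Filter.atTop (nhds 0) := by
    rw [← ENNReal.ofReal_zero]
    refine ENNReal.tendsto_ofReal (Real.tendsto_exp_neg_atTop_nhds_zero.comp ?_)
    exact tendsto_natCast_atTop_atTop.const_mul_atTop hlam
  exact le_antisymm (ge_of_tendsto' h2 h1) zero_le

variable {Ω : Type*} [MeasurableSpace Ω] {P : Measure Ω} [IsProbabilityMeasure P]
  {m : Ω → Measure AxB} {lam δ : ℝ}

theorem ae_strip_lt_top (hlam : 0 < lam)
    (hm : IsPoissonProcess P m (ENNReal.ofReal lam • haar)) :
    ∀ᵐ ω ∂P, ∀ x, m ω (strip δ x) < ∞ := by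
  have h := ae_all_iff.2 fun T =>
    hm.ae_lt_top (measurableSet_window T) (intensity_window_ne_top hlam T)
  filter_upwards [h] with ω hω x
  obtain ⟨T, hT⟩ := exists_strip_subset_window (δ := δ) x
  exact (measure_mono hT).trans_lt (hω T)

/-- Cut a window into vertical slabs of width `1 / (n + 1)`. A tie puts two points in one slab,
which has probability at most the square of the slab's intensity. The sum of these squares is at
most the largest slab intensity times the intensity of the window, and tends to `0`. -/
theorem ae_injOn_a (hlam : 0 < lam)
    (hm : IsPoissonProcess P m (ENNReal.ofReal lam • haar)) :
    ∀ᵐ ω ∂P, ∀ x ∈ pointsOf (m ω), ∀ y ∈ pointsOf (m ω), x.a = y.a → x = y := by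
  have key : ∀ T : ℕ, ∀ᵐ ω ∂P, ∀ x ∈ pointsOf (m ω), ∀ y ∈ pointsOf (m ω),
      x ∈ window T → y ∈ window T → x.a = y.a → x = y := by
    intro T
    rw [ae_iff]
    set c : ℝ → ℝ≥0∞ := fun s => ENNReal.ofReal lam * (ENNReal.ofReal (1 / (1 / ((T : ℝ) + 1)) ^ 2) *
        ENNReal.ofReal (1 / s) * ENNReal.ofReal (2 * T)) with hc
    have h1 : ∀ n : ℕ, P {ω | ¬ ∀ x ∈ pointsOf (m ω), ∀ y ∈ pointsOf (m ω),
        x ∈ window T → y ∈ window T → x.a = y.a → x = y} ≤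
        c (n + 1) * (ENNReal.ofReal lam • haar) (window T) := by
      intro n
      have hs : (0 : ℝ) < n + 1 := by positivity
      have hmeas : Measurable fun x : AxB => ⌊x.a * ((n : ℝ) + 1)⌋ :=
        Int.measurable_floor.comp (measurable_a.mul_const _)
      have hV : ∀ i : ℤ, MeasurableSet (window T ∩ (fun x => ⌊x.a * ((n : ℝ) + 1)⌋) ⁻¹' {i}) :=
        fun i => (measurableSet_window T).inter (hmeas (measurableSet_singleton i))
      calc _ ≤ P (⋃ i : ℤ, {ω | 2 ≤ m ω (window T ∩ (fun x => ⌊x.a * ((n : ℝ) + 1)⌋) ⁻¹' {i})}) := by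
            refine measure_mono fun ω hω => ?_
            simp only [Set.mem_ofPred_eq, not_forall] at hω
            obtain ⟨x, hx, y, hy, hxW, hyW, hxy, hne⟩ := hω
            refine Set.mem_iUnion.2 ⟨⌊x.a * ((n : ℝ) + 1)⌋, ?_⟩
            classical
            have := hm.card_le_measure (ω := ω) (F := {x, y})
              (B := window T ∩ (fun x => ⌊x.a * ((n : ℝ) + 1)⌋) ⁻¹' {⌊x.a * ((n : ℝ) + 1)⌋}) (by
                intro z hz
                simp only [Finset.coe_insert, Finset.coe_singleton, Set.mem_insert_iff,
                  Set.mem_singleton_iff] at hz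
                rcases hz with rfl | rfl
                · exact ⟨hx, hxW, rfl⟩
                · exact ⟨hy, hyW, by simp [hxy]⟩)
            rwa [Finset.card_pair hne] at this
        _ ≤ ∑' i : ℤ, P {ω | 2 ≤ m ω (window T ∩ (fun x => ⌊x.a * ((n : ℝ) + 1)⌋) ⁻¹' {i})} :=
            measure_iUnion_le _
        _ ≤ ∑' i : ℤ, c (n + 1) * (ENNReal.ofReal lam • haar)
              (window T ∩ (fun x => ⌊x.a * ((n : ℝ) + 1)⌋) ⁻¹' {i}) := by
            refine ENNReal.tsum_le_tsum fun i => (hm.measure_two_le (hV i)).trans ?_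
            rw [pow_two]
            gcongr
            exact intensity_window_slab_le T hs i
        _ = _ := by
            rw [ENNReal.tsum_mul_left,
              tsum_measure_inter_preimage_singleton _ hmeas (measurableSet_window T)]
    have h2 : Filter.Tendsto (fun n : ℕ => c (n + 1) * (ENNReal.ofReal lam • haar) (window T))
        Filter.atTop (nhds 0) := by
      have h3 : Filter.Tendsto (fun n : ℕ => ENNReal.ofReal (1 / ((n : ℝ) + 1)))
          Filter.atTop (nhds 0) := by
        rw [← ENNReal.ofReal_zero]
        exact ENNReal.tendsto_ofReal tendsto_one_div_add_atTop_nhds_zero_nat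
      have h4 := ENNReal.Tendsto.mul_const (ENNReal.Tendsto.const_mul
        (ENNReal.Tendsto.mul_const (ENNReal.Tendsto.const_mul
        (a := ENNReal.ofReal (1 / (1 / ((T : ℝ) + 1)) ^ 2)) h3
          (Or.inr ENNReal.ofReal_ne_top)) (b := ENNReal.ofReal (2 * T))
          (Or.inr ENNReal.ofReal_ne_top)) (a := ENNReal.ofReal lam)
          (Or.inr ENNReal.ofReal_ne_top)) (b := (ENNReal.ofReal lam • haar) (window T))
          (Or.inr (intensity_window_ne_top hlam T))
      simpa only [mul_zero, zero_mul] using h4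
    exact le_antisymm (ge_of_tendsto' h2 h1) zero_le
  filter_upwards [ae_all_iff.2 key] with ω hω x hx y hy hxy
  obtain ⟨T, h1, h2⟩ := exists_mem_window x |y.b|
  refine hω T x hx y hy ⟨h1, ?_, ?_⟩ ⟨hxy ▸ h1, ?_, ?_⟩ hxy
  · linarith [neg_abs_le x.b, abs_nonneg y.b]
  · linarith [le_abs_self x.b, abs_nonneg y.b]
  · linarith [neg_abs_le y.b, abs_nonneg x.b]
  · linarith [le_abs_self y.b, abs_nonneg x.b]

/-! ### Points of the process in cones near the boundary `a = 0` -/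

/-- A rectangle of intensity independent of `j`, inside the cone
`{x | |x.b - c| ≤ δ x.a / 2}`. -/
def coneCell (δ c : ℝ) (j : ℕ) : Set AxB :=
  {x | (1 / 2 ^ (j + 1) ≤ x.a ∧ x.a < 1 / 2 ^ j) ∧ c - δ / 2 ^ (j + 2) ≤ x.b ∧
    x.b ≤ c + δ / 2 ^ (j + 2)}

theorem intensity_coneCell (hlam : 0 < lam) (c : ℝ) (j : ℕ) :
    (ENNReal.ofReal lam • haar) (coneCell δ c j) = ENNReal.ofReal (lam * (δ / 2)) := by
  unfold coneCell
  rw [intensity_Ico_Icc hlam (by positivity)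
    (one_div_le_one_div_of_le (by positivity) (pow_le_pow_right₀ one_le_two (Nat.le_succ j)))]
  congr 2
  rw [show (2 : ℝ) ^ (j + 1) = 2 ^ j * 2 from pow_succ _ _,
    show (2 : ℝ) ^ (j + 2) = 2 ^ j * 4 by rw [pow_add]; norm_num]
  field_simp
  ring

theorem measurableSet_coneCell (c : ℝ) (j : ℕ) : MeasurableSet (coneCell δ c j) :=
  measurableSet_Ico_Icc _ _ _ _

theorem disjoint_coneCell {c : ℝ} {i j : ℕ} (hij : i < j) :
    Disjoint (coneCell δ c i) (coneCell δ c j) := by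
  refine Set.disjoint_left.2 fun x hx hx' => ?_
  have h1 := hx.1.1
  have h2 := hx'.1.2
  have h3 : (1 : ℝ) / 2 ^ j ≤ 1 / 2 ^ (i + 1) :=
    one_div_le_one_div_of_le (by positivity) (pow_le_pow_right₀ one_le_two hij)
  linarith

theorem intensity_biUnion_coneCell (hlam : 0 < lam) (c : ℝ) (J n : ℕ) :
    (ENNReal.ofReal lam • haar) (⋃ j ∈ Finset.range n, coneCell δ c (J + j))
      = n * ENNReal.ofReal (lam * (δ / 2)) := by
  rw [measure_biUnion_finset]
  · simp [intensity_coneCell hlam, -Measure.smul_apply]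
  · intro i _ j _ hij
    rcases lt_or_gt_of_ne hij with h | h
    · exact disjoint_coneCell (by omega)
    · exact (disjoint_coneCell (by omega)).symm
  · exact fun j _ => measurableSet_coneCell _ _

/-- The cone depends on the random point `y`, so `y.b` is rounded down to a multiple `k * η` and the
cone is replaced by `n` cells centred at the deterministic height `k * η`. These lie to the left of
the window by `hJ`, hence are independent of the points there, and are all empty with probability
`exp (-n λ δ / 2)`. Summing over `k` gives the intensity of the window times this factor. -/
theorem ae_exists_mem_cone_window (hlam : 0 < lam) (hδ : 0 < δ)
    (hm : IsPoissonProcess P m (ENNReal.ofReal lam • haar)) {T J : ℕ} (hJ : T + 1 ≤ 2 ^ J) :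
    ∀ᵐ ω ∂P, ∀ y ∈ pointsOf (m ω), y ∈ window T →
      ∃ x ∈ pointsOf (m ω), x.a < 1 / 2 ^ J ∧ |x.b - y.b| ≤ δ * x.a := by
  rw [ae_iff]
  have hJ' : (1 : ℝ) / 2 ^ J ≤ 1 / (T + 1) :=
    one_div_le_one_div_of_le (by positivity) (by exact_mod_cast hJ)
  set Λ := ENNReal.ofReal lam • haar with hΛ
  have h1 : ∀ n : ℕ, P {ω | ¬ ∀ y ∈ pointsOf (m ω), y ∈ window T →
      ∃ x ∈ pointsOf (m ω), x.a < 1 / 2 ^ J ∧ |x.b - y.b| ≤ δ * x.a} ≤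
      Λ (window T) * ENNReal.ofReal (Real.exp (-(n * (lam * (δ / 2))))) := by
    intro n
    -- Half the height of the smallest of the `n` cells. A cell uses only half the aperture of the
    -- cone at its left edge, so the rounding error, at most `η`, fits in the other half.
    set η : ℝ := δ / 2 ^ (J + n + 1) with hη
    have hη0 : 0 < η := by positivity
    have hmeas : Measurable fun x : AxB => ⌊x.b / η⌋ :=
      Int.measurable_floor.comp (measurable_b.div_const _)
    have hV : ∀ k : ℤ, MeasurableSet (window T ∩ (fun x => ⌊x.b / η⌋) ⁻¹' {k}) :=
      fun k => (measurableSet_window T).inter (hmeas (measurableSet_singleton k))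
    set U : ℤ → Set AxB := fun k => ⋃ j ∈ Finset.range n, coneCell δ (k * η) (J + j) with hU
    have hUm : ∀ k, MeasurableSet (U k) := fun k =>
      Finset.measurableSet_biUnion _ fun j _ => measurableSet_coneCell _ _
    have hUΛ : ∀ k, Λ (U k) = n * ENNReal.ofReal (lam * (δ / 2)) :=
      fun k => intensity_biUnion_coneCell hlam _ _ _
    have hUr : ∀ k, (Λ (U k)).toReal = n * (lam * (δ / 2)) := fun k => by
      rw [hUΛ, ENNReal.toReal_mul, ENNReal.toReal_natCast,
        ENNReal.toReal_ofReal (by positivity)]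
    have hUt : ∀ k, Λ (U k) ≠ ∞ := fun k => by
      rw [hUΛ]
      exact ENNReal.mul_ne_top (ENNReal.natCast_ne_top n) ENNReal.ofReal_ne_top
    have hd : ∀ k, Disjoint (window T ∩ (fun x => ⌊x.b / η⌋) ⁻¹' {k}) (U k) := by
      refine fun k => Set.disjoint_left.2 fun x hx hx' => ?_
      obtain ⟨j, -, hj⟩ := Set.mem_iUnion₂.1 hx'
      have h1 := hx.1.1
      have h2 := hj.1.2
      have h3 : (1 : ℝ) / 2 ^ (J + j) ≤ 1 / 2 ^ J :=
        one_div_le_one_div_of_le (by positivity) (pow_le_pow_right₀ one_le_two (by omega))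
      linarith
    calc _ ≤ P (⋃ k : ℤ, {ω | m ω (window T ∩ (fun x => ⌊x.b / η⌋) ⁻¹' {k}) ≠ 0 ∧
            m ω (U k) = 0}) := by
          refine measure_mono fun ω hω => ?_
          simp only [Set.mem_ofPred_eq, not_forall] at hω
          obtain ⟨y, hy, hyW, hno⟩ := hω
          refine Set.mem_iUnion.2 ⟨⌊y.b / η⌋, ?_, ?_⟩
          · exact (hm.measure_ne_zero_iff (hV _)).2 ⟨y, hy, hyW, rfl⟩
          · by_contra h0
            obtain ⟨x, hx, hxU⟩ := (hm.measure_ne_zero_iff (hUm _)).1 h0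
            obtain ⟨j, hj, hxj⟩ := Set.mem_iUnion₂.1 hxU
            have hj' : j < n := Finset.mem_range.1 hj
            obtain ⟨⟨h1, h2⟩, h3, h4⟩ := hxj
            have h5 : (1 : ℝ) / 2 ^ (J + j) ≤ 1 / 2 ^ J :=
              one_div_le_one_div_of_le (by positivity) (pow_le_pow_right₀ one_le_two (by omega))
            have h6 : η ≤ δ / 2 ^ (J + j + 2) :=
              div_le_div_of_nonneg_left hδ.le (by positivity)
                (pow_le_pow_right₀ one_le_two (by omega))
            have h7 : (⌊y.b / η⌋ : ℝ) * η ≤ y.b := (le_div_iff₀ hη0).1 (Int.floor_le _)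
            have h8 : y.b < (⌊y.b / η⌋ + 1) * η := (div_lt_iff₀ hη0).1 (Int.lt_floor_add_one _)
            have h9 : δ / 2 ^ (J + j + 2) + δ / 2 ^ (J + j + 2) = δ * (1 / 2 ^ (J + j + 1)) := by
              field_simp
              ring
            have h10 := mul_le_mul_of_nonneg_left h1 hδ.le
            refine hno ⟨x, hx, h2.trans_le h5, abs_le.2 ⟨?_, ?_⟩⟩ <;> linarith
      _ ≤ ∑' k : ℤ, P {ω | m ω (window T ∩ (fun x => ⌊x.b / η⌋) ⁻¹' {k}) ≠ 0 ∧
            m ω (U k) = 0} := measure_iUnion_le _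
      _ ≤ ∑' k : ℤ, Λ (window T ∩ (fun x => ⌊x.b / η⌋) ⁻¹' {k}) *
            ENNReal.ofReal (Real.exp (-(n * (lam * (δ / 2))))) := by
          refine ENNReal.tsum_le_tsum fun k => ?_
          rw [← hUr k]
          exact hm.measure_ne_zero_inter_eq_zero_le (hV k) (hUm k) (hd k) (hUt k)
      _ = _ := by
          rw [ENNReal.tsum_mul_right,
            tsum_measure_inter_preimage_singleton _ hmeas (measurableSet_window T)]
  have h2 : Filter.Tendsto (fun n : ℕ => Λ (window T) *
      ENNReal.ofReal (Real.exp (-(n * (lam * (δ / 2)))))) Filter.atTop (nhds 0) := by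
    have h3 : Filter.Tendsto (fun n : ℕ => ENNReal.ofReal (Real.exp (-(n * (lam * (δ / 2))))))
        Filter.atTop (nhds 0) := by
      rw [← ENNReal.ofReal_zero]
      refine ENNReal.tendsto_ofReal (Real.tendsto_exp_neg_atTop_nhds_zero.comp ?_)
      exact tendsto_natCast_atTop_atTop.atTop_mul_const (by positivity)
    simpa only [mul_zero] using
      ENNReal.Tendsto.const_mul h3 (Or.inr (intensity_window_ne_top hlam T))
  exact le_antisymm (ge_of_tendsto' h2 h1) zero_le

theorem ae_exists_mem_cone (hlam : 0 < lam) (hδ : 0 < δ)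
    (hm : IsPoissonProcess P m (ENNReal.ofReal lam • haar)) :
    ∀ᵐ ω ∂P, ∀ y ∈ pointsOf (m ω), ∀ ε > 0,
      ∃ x ∈ pointsOf (m ω), x.a < ε ∧ |x.b - y.b| ≤ δ * x.a := by
  have key : ∀ T J : ℕ, ∀ᵐ ω ∂P, T + 1 ≤ 2 ^ J → ∀ y ∈ pointsOf (m ω), y ∈ window T →
      ∃ x ∈ pointsOf (m ω), x.a < 1 / 2 ^ J ∧ |x.b - y.b| ≤ δ * x.a := by
    intro T J
    by_cases hJ : T + 1 ≤ 2 ^ J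
    · filter_upwards [ae_exists_mem_cone_window hlam hδ hm hJ] with ω hω _ using hω
    · exact Filter.Eventually.of_forall fun ω h => absurd h hJ
  filter_upwards [ae_all_iff.2 fun T => ae_all_iff.2 (key T)] with ω hω y hy ε hε
  obtain ⟨T, hT⟩ := exists_window hδ y
  obtain ⟨K, hK⟩ := exists_pow_lt_of_lt_one hε (one_half_lt_one (α := ℝ))
  -- The exponent `K + T` serves both purposes: `T` places the cells outside the window, `K` places
  -- them below `ε`.
  have h1 : T + 1 ≤ 2 ^ (K + T) := by
    calc T + 1 ≤ 2 ^ T := Nat.lt_two_pow_self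
      _ ≤ _ := Nat.pow_le_pow_right (by norm_num) (by omega)
  obtain ⟨x, hx, hx1, hx2⟩ := hω T (K + T) h1 y hy hT
  refine ⟨x, hx, hx1.trans_le (le_trans ?_ hK.le), hx2⟩
  rw [one_div_pow]
  exact one_div_le_one_div_of_le (by positivity) (pow_le_pow_right₀ one_le_two (by omega))

end AxB

/-! ### Subcriticality: no arbitrarily long strictly increasing chains -/

namespace AxB

/-- There is a chain of `n` steps from `x` in `N`, each step going to a point of the strip at the
previous one that lies in a strictly later column of the grid of mesh `1 / s`. -/
def SepChain (δ s : ℝ) (N : Set AxB) : ℕ → AxB → Prop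
  | 0, x => x ∈ N
  | n + 1, x => x ∈ N ∧ ∃ y ∈ strip δ x, ⌊x.a * s⌋ < ⌊y.a * s⌋ ∧ SepChain δ s N n y

/-- There is a chain of `n` steps from `x` in `N`, each step going to a point of the strip at the
previous one that has a strictly larger first coordinate. -/
def StrictChain (δ : ℝ) (N : Set AxB) : ℕ → AxB → Prop
  | 0, x => x ∈ N
  | n + 1, x => x ∈ N ∧ ∃ y ∈ strip δ x, x.a < y.a ∧ StrictChain δ N n y

theorem SepChain.mem {δ s : ℝ} {N : Set AxB} {n : ℕ} {x : AxB} (h : SepChain δ s N n x) :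
    x ∈ N := by
  cases n with
  | zero => exact h
  | succ n => exact h.1

/-- A chain of `n` steps has finitely many gaps, all positive, so a fine enough grid puts
consecutive points in different columns. -/
theorem StrictChain.eventually_sepChain {δ : ℝ} {N : Set AxB} {n : ℕ} {x : AxB}
    (h : StrictChain δ N n x) : ∀ᶠ k : ℕ in Filter.atTop, SepChain δ k N n x := by
  induction n generalizing x with
  | zero => exact Filter.Eventually.of_forall fun _ => h
  | succ n ih =>
    obtain ⟨hx, y, hy, hlt, hc⟩ := h
    obtain ⟨K, hK⟩ := exists_nat_gt (1 / (y.a - x.a))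
    filter_upwards [ih hc, Filter.eventually_ge_atTop K] with k hk hKk
    refine ⟨hx, y, hy, ?_, hk⟩
    have h1 : 1 / (y.a - x.a) < k := hK.trans_le (by exact_mod_cast hKk)
    have h2 : 1 < k * (y.a - x.a) := (div_lt_iff₀ (sub_pos.2 hlt)).1 h1
    rw [Int.lt_iff_add_one_le, Int.le_floor]
    push_cast
    linarith [Int.floor_le (x.a * k)]

/-- The cell of the grid of mesh `1 / s` that contains `x`. -/
noncomputable def cell (s : ℝ) (x : AxB) : ℤ × ℤ := (⌊x.a * s⌋, ⌊x.b * s⌋)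

theorem measurable_cell (s : ℝ) : Measurable (cell s) :=
  (Int.measurable_floor.comp (measurable_a.mul_const _)).prodMk
    (Int.measurable_floor.comp (measurable_b.mul_const _))

theorem measurableSet_cell (s : ℝ) (S : Set (ℤ × ℤ)) : MeasurableSet (cell s ⁻¹' S) :=
  measurable_cell s .of_discrete

theorem cell_eq_iff {s : ℝ} (hs : 0 < s) {x : AxB} {p : ℤ × ℤ} :
    cell s x = p ↔ (p.1 / s ≤ x.a ∧ x.a < (p.1 + 1) / s) ∧ p.2 / s ≤ x.b ∧ x.b < (p.2 + 1) / s := by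
  rw [div_le_iff₀ hs, lt_div_iff₀ hs, div_le_iff₀ hs, lt_div_iff₀ hs, ← Int.floor_eq_iff,
    ← Int.floor_eq_iff]
  exact Prod.ext_iff

/-- The cells in later columns that are met by the strip at some point of the cell `p`. -/
def laterCells (δ s : ℝ) (p : ℤ × ℤ) : Set (ℤ × ℤ) :=
  {q | p.1 < q.1 ∧ ∃ x y : AxB, cell s x = p ∧ cell s y = q ∧ y ∈ strip δ x}

/-- In units of `1 / s`, these cells lie to the right of `p.1 + 1` and within height `2δ(p.1 + 1) +
3`: the strip itself, one unit for the cell of `x`, and one on each side for the cells it meets only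
partly. Dividing height by left edge gives `2δ` plus an error that is small in far columns. -/
theorem intensity_laterCells_le {lam δ s : ℝ} (hlam : 0 < lam) (hδ : 0 < δ) (hs : 0 < s)
    {p : ℤ × ℤ} (hp : 0 ≤ p.1) :
    (ENNReal.ofReal lam • haar) (cell s ⁻¹' laterCells δ s p)
      ≤ ENNReal.ofReal (lam * (2 * δ + 3 / (p.1 + 1))) := by
  have hp' : (0 : ℝ) < p.1 + 1 := by exact_mod_cast Int.lt_add_one_of_le hp
  have hsub : cell s ⁻¹' laterCells δ s p ⊆ {z | (p.1 + 1) / s ≤ z.a ∧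
      (p.2 - 1) / s - δ * ((p.1 + 1) / s) ≤ z.b ∧
      z.b ≤ (p.2 + 2) / s + δ * ((p.1 + 1) / s)} := by
    rintro z ⟨hlt, x, y, hx, hy, hyx⟩
    obtain ⟨⟨-, h1⟩, h2, h3⟩ := (cell_eq_iff hs).1 hx
    obtain ⟨-, h4, h5⟩ := (cell_eq_iff hs).1 hy
    obtain ⟨⟨h6, -⟩, h7, h8⟩ := (cell_eq_iff hs).1 (rfl : cell s z = cell s z)
    have h9 := mul_lt_mul_of_pos_left h1 hδ
    obtain ⟨-, h10, h11⟩ := hyx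
    have h12 : (p.1 + 1 : ℝ) ≤ (cell s z).1 := by exact_mod_cast hlt
    refine ⟨le_trans (by gcongr) h6, ?_, ?_⟩
    · simp only [add_div, sub_div] at *
      linarith
    · have h13 : (p.2 + 2 : ℝ) / s = (p.2 + 1) / s + 1 / s := by ring
      simp only [add_div] at *
      linarith
  refine (measure_mono hsub).trans ?_
  rw [intensity_Ici_Icc hlam (by positivity)]
  apply le_of_eq
  congr 2
  field_simp
  ring

variable {Ω : Type*} [MeasurableSpace Ω] {P : Measure Ω} [IsProbabilityMeasure P]
  {m : Ω → Measure AxB} {lam δ : ℝ}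

/-- Union bound over the next cell of the chain. The visited cells are carried along in the list,
the most recent first; their columns are strictly monotone, so they are distinct and occupied
independently. Each step sums the intensity over the later cells and contributes a factor `r`. -/
theorem measure_sepChain_cells_le (hlam : 0 < lam) (hδ : 0 < δ)
    (hm : IsPoissonProcess P m (ENNReal.ofReal lam • haar)) {s r : ℝ} {M : ℤ} (hs : 0 < s)
    (hM : 0 ≤ M) (hr : ∀ i : ℤ, M ≤ i → lam * (2 * δ + 3 / (i + 1)) ≤ r) (n : ℕ)
    (p : ℤ × ℤ) (L : List (ℤ × ℤ)) (hp : M ≤ p.1)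
    (hL : (p :: L).Pairwise fun p q => q.1 < p.1) :
    P {ω | (∀ q ∈ p :: L, m ω (cell s ⁻¹' {q}) ≠ 0) ∧
        ∃ x ∈ cell s ⁻¹' {p}, SepChain δ s (pointsOf (m ω)) n x} ≤
      ((p :: L).map fun q => (ENNReal.ofReal lam • haar) (cell s ⁻¹' {q})).prod *
        ENNReal.ofReal r ^ n := by
  induction n generalizing p L with
  | zero =>
    rw [pow_zero, mul_one]
    have h1 := hm.measure_forall_ne_zero_le ((p :: L).map fun q => cell s ⁻¹' {q})
      (by simp only [List.mem_map]; rintro _ ⟨q, -, rfl⟩; exact measurableSet_cell s _)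
      (by
        refine List.pairwise_map.2 (hL.imp fun {q q'} h => ?_)
        refine Set.disjoint_left.2 fun x hx hx' => h.ne ?_
        rw [← Set.mem_singleton_iff.1 hx, ← Set.mem_singleton_iff.1 hx'])
    rw [List.map_map] at h1
    refine le_trans (measure_mono fun ω hω => ?_) h1
    rintro B hB
    obtain ⟨q, hq, rfl⟩ := List.mem_map.1 hB
    exact hω.1 q hq
  | succ n ih =>
    set Λ := ENNReal.ofReal lam • haar with hΛ
    calc _ ≤ P (⋃ q : laterCells δ s p,
            {ω | (∀ q' ∈ (q : ℤ × ℤ) :: p :: L, m ω (cell s ⁻¹' {q'}) ≠ 0) ∧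
              ∃ x ∈ cell s ⁻¹' {(q : ℤ × ℤ)}, SepChain δ s (pointsOf (m ω)) n x}) := by
          refine measure_mono ?_
          rintro ω ⟨hne, x, hx, hxN, y, hy, hlt, hc⟩
          have hx' : cell s x = p := hx
          refine Set.mem_iUnion.2 ⟨⟨cell s y, ?_, x, y, hx, rfl, hy⟩, ?_, y, rfl, hc⟩
          · rw [← hx']
            exact hlt
          · intro q' hq'
            rcases List.mem_cons.1 hq' with rfl | hq'
            · exact (hm.measure_ne_zero_iff (measurableSet_cell s _)).2 ⟨y, hc.mem, rfl⟩
            · exact hne q' hq'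
      _ ≤ ∑' q : laterCells δ s p,
            P {ω | (∀ q' ∈ (q : ℤ × ℤ) :: p :: L, m ω (cell s ⁻¹' {q'}) ≠ 0) ∧
              ∃ x ∈ cell s ⁻¹' {(q : ℤ × ℤ)}, SepChain δ s (pointsOf (m ω)) n x} :=
          measure_iUnion_le _
      _ ≤ ∑' q : laterCells δ s p, Λ (cell s ⁻¹' {(q : ℤ × ℤ)}) *
            (((p :: L).map fun q => Λ (cell s ⁻¹' {q})).prod * ENNReal.ofReal r ^ n) := by
          refine ENNReal.tsum_le_tsum fun q => ?_
          have h1 := ih (q : ℤ × ℤ) (p :: L) (hp.trans q.2.1.le) (List.pairwise_cons.2 ⟨?_, hL⟩)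
          · rwa [List.map_cons, List.prod_cons, mul_assoc] at h1
          · intro q' hq'
            rcases List.mem_cons.1 hq' with rfl | hq'
            · exact q.2.1
            · exact ((List.pairwise_cons.1 hL).1 q' hq').trans q.2.1
      _ = Λ (cell s ⁻¹' laterCells δ s p) *
            (((p :: L).map fun q => Λ (cell s ⁻¹' {q})).prod * ENNReal.ofReal r ^ n) := by
          rw [ENNReal.tsum_mul_right, tsum_measure_preimage_singleton (Set.to_countable _)
            fun q _ => measurableSet_cell s _]
      _ ≤ ENNReal.ofReal r *
            (((p :: L).map fun q => Λ (cell s ⁻¹' {q})).prod * ENNReal.ofReal r ^ n) := by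
          gcongr
          exact (intensity_laterCells_le hlam hδ hs (hM.trans hp)).trans
            (ENNReal.ofReal_le_ofReal (hr _ hp))
      _ = _ := by rw [pow_succ]; ring

/-- The mesh condition places every cell meeting the window in a column at least `M`, where `r`
bounds the growth factor, and keeps all these cells inside the window of index `2 * T + 1`. -/
theorem measure_sepChain_window_le (hlam : 0 < lam) (hδ : 0 < δ)
    (hm : IsPoissonProcess P m (ENNReal.ofReal lam • haar)) {s r : ℝ} {M : ℤ} (hM : 0 ≤ M)
    (hr : ∀ i : ℤ, M ≤ i → lam * (2 * δ + 3 / (i + 1)) ≤ r) (T : ℕ)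
    (hs : (M + 2) * (T + 1) ≤ s) (n : ℕ) :
    P {ω | ∃ x ∈ window T, SepChain δ s (pointsOf (m ω)) n x} ≤
      (ENNReal.ofReal lam • haar) (window (2 * T + 1)) * ENNReal.ofReal r ^ n := by
  set Λ := ENNReal.ofReal lam • haar with hΛ
  have hM' : (0 : ℝ) ≤ M := by exact_mod_cast hM
  have hT : (0 : ℝ) < (T : ℝ) + 1 := by positivity
  have hs2 : 2 * ((T : ℝ) + 1) ≤ s := le_trans (by nlinarith) hs
  have hs0 : 0 < s := by linarith
  have hcol : ∀ x ∈ window T, M ≤ (cell s x).1 := by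
    intro x hx
    refine Int.le_floor.2 ?_
    have h1 := hx.1
    rw [div_le_iff₀ hT] at h1
    have h2 := mul_le_mul_of_nonneg_left hs x.a_pos.le
    nlinarith
  calc _ ≤ P (⋃ p : cell s '' window T, {ω | (∀ q ∈ [(p : ℤ × ℤ)], m ω (cell s ⁻¹' {q}) ≠ 0) ∧
        ∃ x ∈ cell s ⁻¹' {(p : ℤ × ℤ)}, SepChain δ s (pointsOf (m ω)) n x}) := by
        refine measure_mono ?_
        rintro ω ⟨x, hx, hc⟩
        refine Set.mem_iUnion.2 ⟨⟨cell s x, x, hx, rfl⟩, ?_, x, rfl, hc⟩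
        intro q hq
        rw [List.mem_singleton.1 hq]
        exact (hm.measure_ne_zero_iff (measurableSet_cell s _)).2 ⟨x, hc.mem, rfl⟩
    _ ≤ ∑' p : cell s '' window T, P {ω | (∀ q ∈ [(p : ℤ × ℤ)], m ω (cell s ⁻¹' {q}) ≠ 0) ∧
        ∃ x ∈ cell s ⁻¹' {(p : ℤ × ℤ)}, SepChain δ s (pointsOf (m ω)) n x} :=
        measure_iUnion_le _
    _ ≤ ∑' p : cell s '' window T, Λ (cell s ⁻¹' {(p : ℤ × ℤ)}) * ENNReal.ofReal r ^ n := by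
        refine ENNReal.tsum_le_tsum fun ⟨p, x, hx, hp⟩ => ?_
        have h1 := measure_sepChain_cells_le hlam hδ hm hs0 hM hr n p [] (hp ▸ hcol x hx)
          (List.pairwise_singleton _ _)
        simpa only [List.map_cons, List.map_nil, List.prod_singleton] using h1
    _ = Λ (cell s ⁻¹' (cell s '' window T)) * ENNReal.ofReal r ^ n := by
        rw [ENNReal.tsum_mul_right, tsum_measure_preimage_singleton (Set.to_countable _)
            fun q _ => measurableSet_cell s _]
    _ ≤ _ := by
        gcongr
        rintro z ⟨x, hx, hxz⟩
        obtain ⟨⟨h1, h2⟩, h3, h4⟩ := (cell_eq_iff hs0).1 hxz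
        obtain ⟨⟨h5, h6⟩, h7, h8⟩ := (cell_eq_iff hs0).1 (rfl : cell s z = cell s z)
        obtain ⟨h9, h10, h11⟩ := hx
        simp only [add_div] at *
        have h12 : 1 / s ≤ 1 / (2 * ((T : ℝ) + 1)) := one_div_le_one_div_of_le (by positivity) hs2
        have h13 : 1 / (2 * ((T : ℝ) + 1)) + 1 / (2 * ((T : ℝ) + 1)) = 1 / (T + 1) := by
          field_simp
          norm_num
        have h14 : 1 / (2 * ((T : ℝ) + 1)) ≤ 1 := by
          rw [div_le_one (by positivity)]
          linarith [(Nat.cast_nonneg T : (0 : ℝ) ≤ T)]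
        have h15 : (0 : ℝ) ≤ T := Nat.cast_nonneg T
        refine ⟨?_, ?_, ?_⟩
        · rw [show ((2 * T + 1 : ℕ) : ℝ) + 1 = 2 * (T + 1) by push_cast; ring]
          linarith
        · push_cast
          linarith
        · push_cast
          linarith

theorem measure_strictChain_window_le (hlam : 0 < lam) (hδ : 0 < δ)
    (hm : IsPoissonProcess P m (ENNReal.ofReal lam • haar)) {r : ℝ} (hr : 2 * δ * lam < r)
    (T n : ℕ) :
    P {ω | ∃ x ∈ window T, StrictChain δ (pointsOf (m ω)) n x} ≤
      (ENNReal.ofReal lam • haar) (window (2 * T + 1)) * ENNReal.ofReal r ^ n := by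
  -- From column `M` on, the discretisation error `3λ / (i + 1)` is below the slack `r - 2δλ`.
  obtain ⟨M, hM⟩ := exists_nat_gt (3 * lam / (r - 2 * δ * lam))
  have hM' : ∀ i : ℤ, (M : ℤ) ≤ i → lam * (2 * δ + 3 / (i + 1)) ≤ r := by
    intro i hi
    have h1 : (M : ℝ) ≤ i := by exact_mod_cast hi
    have h2 : (0 : ℝ) < i + 1 := by linarith [(Nat.cast_nonneg M : (0 : ℝ) ≤ M)]
    have h3 := (div_lt_iff₀ (sub_pos.2 hr)).1 hM
    have h4 : lam * (3 / (i + 1)) ≤ r - 2 * δ * lam := by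
      rw [← mul_div_assoc, div_le_iff₀ h2]
      nlinarith
    linarith
  obtain ⟨K, hK⟩ := exists_nat_ge (((M : ℤ) + 2 : ℝ) * (T + 1))
  have hsub : {ω | ∃ x ∈ window T, StrictChain δ (pointsOf (m ω)) n x} ⊆
      ⋃ j : ℕ, ⋂ k ≥ j, {ω | ∃ x ∈ window T, SepChain δ (k : ℕ) (pointsOf (m ω)) n x} := by
    rintro ω ⟨x, hx, hc⟩
    obtain ⟨j, hj⟩ := Filter.eventually_atTop.1 hc.eventually_sepChain
    exact Set.mem_iUnion.2 ⟨j, Set.mem_iInter₂.2 fun k hk => ⟨x, hx, hj k hk⟩⟩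
  refine (measure_mono hsub).trans ?_
  -- The bound is uniform in the mesh, so it passes to the increasing union of the events that hold
  -- for all meshes `k ≥ j`. Measurability of the chain events is not needed.
  rw [Directed.measure_iUnion]
  · refine iSup_le fun j => ?_
    refine (measure_mono (Set.iInter₂_subset (max j K) (le_max_left j K))).trans ?_
    refine measure_sepChain_window_le hlam hδ hm (Int.natCast_nonneg M) hM' T (hK.trans ?_) n
    exact_mod_cast le_max_right j K
  · refine Monotone.directed_le fun i j hij => ?_
    exact Set.biInter_subset_biInter_left fun k hk => le_trans hij hk

theorem ae_exists_not_strictChain (hlam : 0 < lam) (hδ : 0 < δ) (hsub : 2 * δ * lam < 1)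
    (hm : IsPoissonProcess P m (ENNReal.ofReal lam • haar)) :
    ∀ᵐ ω ∂P, ∀ x, ∃ n, ¬ StrictChain δ (pointsOf (m ω)) n x := by
  obtain ⟨r, hr, hr1⟩ := exists_between hsub
  have key : ∀ T : ℕ, ∀ᵐ ω ∂P, ∀ x ∈ window T, ∃ n, ¬ StrictChain δ (pointsOf (m ω)) n x := by
    intro T
    rw [ae_iff]
    have h1 : ∀ n : ℕ,
        P {ω | ¬ ∀ x ∈ window T, ∃ n, ¬ StrictChain δ (pointsOf (m ω)) n x} ≤
        (ENNReal.ofReal lam • haar) (window (2 * T + 1)) * ENNReal.ofReal r ^ n := by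
      intro n
      refine le_trans (measure_mono fun ω hω => ?_)
        (measure_strictChain_window_le hlam hδ hm hr T n)
      simp only [Set.mem_ofPred_eq, not_forall, not_exists, not_not] at hω
      obtain ⟨x, hx, hc⟩ := hω
      exact ⟨x, hx, hc n⟩
    have h2 := ENNReal.Tendsto.const_mul (ENNReal.tendsto_pow_atTop_nhds_zero_of_lt_one
      (ENNReal.ofReal_lt_one.2 hr1)) (Or.inr (intensity_window_ne_top hlam (2 * T + 1)))
    rw [mul_zero] at h2
    exact le_antisymm (ge_of_tendsto' h2 h1) zero_le
  filter_upwards [ae_all_iff.2 key] with ω hω x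
  obtain ⟨T, hT⟩ := exists_window hδ x
  exact hω T x hT

end AxB

/-! ### Deterministic graph structure when all orbits are eventually constant -/

namespace PointShift

variable {α : Type*} {N : Set α} {H : α → α}

theorem iterate_mem (hN : ∀ x ∈ N, H x ∈ N) {x : α} (hx : x ∈ N) (n : ℕ) : H^[n] x ∈ N := by
  induction n with
  | zero => exact hx
  | succ n ih => rw [Function.iterate_succ_apply']; exact hN _ ih

theorem iterate_eq_of_le {x : α} {k n : ℕ} (hk : H (H^[k] x) = H^[k] x) (hn : k ≤ n) :
    H^[n] x = H^[k] x := by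
  induction n, hn using Nat.le_induction with
  | base => rfl
  | succ n _ ih => rw [Function.iterate_succ_apply', ih, hk]

theorem iterate_fixedPt {y : α} (hy : H y = y) (n : ℕ) : H^[n] y = y :=
  iterate_eq_of_le (k := 0) hy (Nat.zero_le n)

theorem fixedPts_subset_primeval : fixedPts N H ⊆ primeval N H := fun y hy =>
  Set.mem_iInter.2 fun n => ⟨y, hy.1, iterate_fixedPt hy.2 n⟩

theorem mem_component_self {x : α} (hx : x ∈ N) : x ∈ component N H x :=
  ⟨hx, Relation.EqvGen.refl x⟩

theorem iterate_mem_component (hN : ∀ x ∈ N, H x ∈ N) {x : α} (hx : x ∈ N) (n : ℕ) :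
    H^[n] x ∈ component N H x := by
  induction n with
  | zero => exact mem_component_self hx
  | succ n ih =>
    have h := hN _ ih.1
    rw [Function.iterate_succ_apply']
    exact ⟨h, ih.2.trans _ _ _ (.rel _ _ ⟨ih.1, h, rfl⟩)⟩

theorem foil_subset_component (hN : ∀ x ∈ N, H x ∈ N) {x : α} (hx : x ∈ N) :
    foil N H x ⊆ component N H x := by
  rintro y ⟨hy, n, hn⟩
  refine ⟨hy, (iterate_mem_component hN hx n).2.trans _ _ _ ?_⟩
  rw [hn]
  exact (iterate_mem_component hN hy n).2.symm

theorem exists_iterate_eq_of_eqvGen {x y : α}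
    (h : Relation.EqvGen (fun u v => u ∈ N ∧ v ∈ N ∧ H u = v) x y) :
    ∃ i j : ℕ, H^[i] x = H^[j] y := by
  induction h with
  | rel u v h => exact ⟨1, 0, h.2.2⟩
  | refl u => exact ⟨0, 0, rfl⟩
  | symm u v _ ih => obtain ⟨i, j, h⟩ := ih; exact ⟨j, i, h.symm⟩
  | trans u v w _ _ ih1 ih2 =>
    obtain ⟨i, j, h⟩ := ih1
    obtain ⟨k, l, h'⟩ := ih2
    -- Apply `H^[k]` to the first coincidence and `H^[j]` to the second; both then pass through
    -- `H^[k + j] v`.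
    refine ⟨k + i, j + l, ?_⟩
    rw [Function.iterate_add_apply, h, Function.iterate_add_apply H j l, ← h',
      ← Function.iterate_add_apply, ← Function.iterate_add_apply, Nat.add_comm]

theorem foil_eq_component (hN : ∀ x ∈ N, H x ∈ N) (hev : ∀ x ∈ N, ∃ k : ℕ, H (H^[k] x) = H^[k] x)
    {x : α} (hx : x ∈ N) : foil N H x = component N H x := by
  refine (foil_subset_component hN hx).antisymm ?_
  rintro y ⟨hy, h⟩
  obtain ⟨i, j, hij⟩ := exists_iterate_eq_of_eqvGen h
  obtain ⟨k, hk⟩ := hev x hx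
  obtain ⟨l, hl⟩ := hev y hy
  refine ⟨hy, k + l, ?_⟩
  have h1 : H^[k + i] x = H^[k] x := iterate_eq_of_le hk (by omega)
  have h2 : H^[l + j] y = H^[l] y := iterate_eq_of_le hl (by omega)
  -- Both sides are terminal points, so the exponents may be raised to `l + k + i` and `k + l + j`,
  -- where the coincidence `hij` applies.
  rw [iterate_eq_of_le hk (by omega), iterate_eq_of_le hl (by omega), ← h1, ← h2,
    ← iterate_eq_of_le (n := l + k + i) (x := x) (k := k + i) (by rw [h1, hk]) (by omega),
    ← iterate_eq_of_le (n := k + l + j) (x := y) (k := l + j) (by rw [h2, hl]) (by omega),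
    Function.iterate_add_apply, hij, ← Function.iterate_add_apply, Nat.add_comm k l]

theorem existsUnique_fixedPt (hN : ∀ x ∈ N, H x ∈ N)
    (hev : ∀ x ∈ N, ∃ k : ℕ, H (H^[k] x) = H^[k] x) {C : Set α} (hC : C ∈ components N H) :
    ∃! y, y ∈ C ∧ y ∈ fixedPts N H := by
  obtain ⟨x, hx, rfl⟩ := hC
  obtain ⟨k, hk⟩ := hev x hx
  refine ⟨H^[k] x, ⟨iterate_mem_component hN hx k, iterate_mem hN hx k, hk⟩, ?_⟩
  rintro z ⟨hz, hzf⟩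
  rw [← foil_eq_component hN hev hx] at hz
  obtain ⟨-, n, hn⟩ := hz
  rw [iterate_fixedPt hzf.2] at hn
  rw [← hn, ← iterate_eq_of_le hk (le_max_left k n),
    iterate_eq_of_le (k := n) (by rw [hn, hzf.2]) (le_max_right k n)]

theorem component_fixedPt (hN : ∀ x ∈ N, H x ∈ N)
    (hev : ∀ x ∈ N, ∃ k : ℕ, H (H^[k] x) = H^[k] x) {y : α} (hy : y ∈ fixedPts N H) :
    component N H y = {x ∈ N | ∃ n : ℕ, H^[n] x = y} := by
  rw [← foil_eq_component hN hev hy.1]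
  ext x
  simp only [foil, iterate_fixedPt hy.2, eq_comm]

/-- All preimages of the terminal point of the orbit of `x` belong to the component of `x`. -/
theorem component_infinite (hN : ∀ x ∈ N, H x ∈ N)
    (hev : ∀ x ∈ N, ∃ k : ℕ, H (H^[k] x) = H^[k] x)
    (hinf : ∀ y ∈ fixedPts N H, {x ∈ N | H x = y}.Infinite) {x : α} (hx : x ∈ N) :
    (component N H x).Infinite := by
  obtain ⟨k, hk⟩ := hev x hx
  refine (hinf (H^[k] x) ⟨iterate_mem hN hx k, hk⟩).mono ?_
  rintro z ⟨hz, hzk⟩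
  refine ⟨hz, (iterate_mem_component hN hx k).2.trans _ _ _ ?_⟩
  rw [← hzk]
  exact (iterate_mem_component hN hz 1).2.symm

theorem typeII_of_mem_components (hN : ∀ x ∈ N, H x ∈ N)
    (hev : ∀ x ∈ N, ∃ k : ℕ, H (H^[k] x) = H^[k] x)
    (hinf : ∀ y ∈ fixedPts N H, {x ∈ N | H x = y}.Infinite) {C : Set α}
    (hC : C ∈ components N H) : TypeII N H C := by
  obtain ⟨x, hx, rfl⟩ := hC
  refine ⟨component_infinite hN hev hinf hx, ?_⟩
  rintro _ ⟨z, hz, rfl⟩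
  rw [foil_eq_component hN hev hz.1]
  exact component_infinite hN hev hinf hz.1

theorem not_acyclic_of_fixedPt {C : Set α} {y : α} (hyC : y ∈ C) (hy : y ∈ fixedPts N H) :
    ¬ Acyclic H C := by
  intro h
  refine h 1 {y} ⟨one_pos, y, Function.minimalPeriod_eq_one_iff_isFixedPt.2 hy.2, ?_⟩
    (Set.singleton_subset_iff.2 hyC)
  ext z
  simp [iterate_fixedPt hy.2, eq_comm]

theorem not_classified {C : Set α} (h : TypeII N H C) (hc : ¬ Acyclic H C) :
    ¬ Classified N H C := by
  rintro (⟨hf, -⟩ | ⟨-, ha, -⟩ | ⟨-, ha, -⟩)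
  · exact h.1 hf
  · exact hc ha
  · exact hc ha

end PointShift

/-! ### The strip point-shift on a configuration without ties -/

namespace AxB

variable {N : Set AxB} {δ : ℝ}

theorem isRightmost_stripShift (hδ : 0 < δ) (hfin : ∀ x, (N ∩ strip δ x).Finite)
    (hinj : ∀ x ∈ N, ∀ y ∈ N, x.a = y.a → x = y) {x : AxB} (hx : x ∈ N) :
    IsRightmost δ N x (stripShift δ N x) := by
  have h : ∃ y, IsRightmost δ N x y := by
    obtain ⟨y, hy, hmax⟩ := Set.exists_max_image _ a (hfin x) ⟨x, hx, mem_strip_self hδ x⟩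
    refine ⟨y, hy, fun z hz => (hmax z hz).lt_or_eq.imp_right fun heq => ?_⟩
    rw [hinj z hz.1 y hy.1 heq]
    exact ⟨rfl, le_rfl⟩
  have h' : x ∈ N ∧ ∃ y, IsRightmost δ N x y := ⟨hx, h⟩
  rw [stripShift, dif_pos h']
  exact h'.2.choose_spec

/-- Without ties, a step of `H` that moves the point strictly increases `a`. The start `H^[k] x` is
arbitrary so that the induction on the length can advance along the orbit. -/
theorem strictChain_iterate {H : AxB → AxB} (hN : ∀ x ∈ N, H x ∈ N ∩ strip δ x)
    (hinj : ∀ x ∈ N, ∀ y ∈ N, x.a = y.a → x = y) {x : AxB} (hx : x ∈ N)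
    (hne : ∀ k : ℕ, H (H^[k] x) ≠ H^[k] x) (n k : ℕ) : StrictChain δ N n (H^[k] x) := by
  have hmem := PointShift.iterate_mem (fun x hx => (hN x hx).1) hx
  induction n generalizing k with
  | zero => exact hmem k
  | succ n ih =>
    have h1 := hN _ (hmem k)
    refine ⟨hmem k, H (H^[k] x), h1.2, ?_, ?_⟩
    · exact lt_of_le_of_ne h1.2.1 fun h => hne k (hinj _ (hmem k) _ h1.1 h).symm
    · rw [← Function.iterate_succ_apply' H]
      exact ih (k + 1)

/-- The cone condition says `y` has its height within the strip at `x`, so `H x` is not to the left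
of `y`. Its height differs from `y.b` by at most `2 δ x.a < δ y.a`, so `H x` lies in the strip at
`y`, whose right-most point is `y`. -/
theorem eq_fixedPt_of_mem_cone {H : AxB → AxB} (hδ : 0 < δ)
    (hH : ∀ x ∈ N, IsRightmost δ N x (H x))
    (hinj : ∀ x ∈ N, ∀ y ∈ N, x.a = y.a → x = y) {x y : AxB} (hx : x ∈ N)
    (hy : y ∈ PointShift.fixedPts N H) (ha : x.a < y.a / 2) (hb : |x.b - y.b| ≤ δ * x.a) :
    H x = y := by
  obtain ⟨hb1, hb2⟩ := abs_le.1 hb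
  have hya := y.a_pos
  obtain ⟨⟨hzN, hz1, hz2, hz3⟩, hzmax⟩ := hH x hx
  have h1 : y.a ≤ (H x).a := by
    rcases hzmax y ⟨hy.1, by linarith, by linarith, by linarith⟩ with h | h
    · exact h.le
    · exact h.1.le
  have h2 := mul_lt_mul_of_pos_left ha hδ
  have h3 : (H x).a ≤ y.a := by
    have h4 := (hH y hy.1).2 (H x) ⟨hzN, h1, by linarith, by linarith⟩
    rw [hy.2] at h4
    rcases h4 with h | h
    · exact h.le
    · exact h.1.le
  exact hinj _ hzN _ hy.1 (h3.antisymm h1)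

/-- Were the preimages finitely many, a cone point to the left of all of them would be a further
one. -/
theorem infinite_preimage_fixedPt {H : AxB → AxB} (hδ : 0 < δ)
    (hH : ∀ x ∈ N, IsRightmost δ N x (H x))
    (hinj : ∀ x ∈ N, ∀ y ∈ N, x.a = y.a → x = y)
    (hcone : ∀ y ∈ N, ∀ ε > 0, ∃ x ∈ N, x.a < ε ∧ |x.b - y.b| ≤ δ * x.a) {y : AxB}
    (hy : y ∈ PointShift.fixedPts N H) : {x ∈ N | H x = y}.Infinite := by
  intro hf
  obtain ⟨z, -, hmin⟩ := Set.exists_min_image _ a hf ⟨y, hy⟩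
  obtain ⟨x, hx, hx1, hx2⟩ := hcone y hy.1 (min z.a (y.a / 2))
    (lt_min z.a_pos (half_pos y.a_pos))
  have h := hmin x ⟨hx, eq_fixedPt_of_mem_cone hδ hH hinj hx hy
    (hx1.trans_le (min_le_right _ _)) hx2⟩
  exact absurd (hx1.trans_le (min_le_left _ _)) (not_lt.2 h)

end AxB

/-! ### Assembly of the almost sure events -/

theorem mainTheorem6 {Ω : Type*} [MeasurableSpace Ω] (P : Measure Ω) [IsProbabilityMeasure P]
    (m : Ω → Measure AxB) (lam δ : ℝ) (hlam : 0 < lam) (hδ : 0 < δ) (hsub : 2 * δ * lam < 1)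
    (hm : IsPoissonProcess P m (ENNReal.ofReal lam • AxB.haar)) :
    -- the `ax+b` group is not unimodular
    (AxB.haar.IsHaarMeasure ∧ ¬ AxB.haar.IsMulRightInvariant) ∧
    ∀ᵐ ω ∂P, ∀ (N : Set AxB) (H : AxB → AxB),
      N = pointsOf (m ω) → H = AxB.stripShift δ N →
      -- the strip point-shift is well defined, without ties
      (∀ x ∈ N, m ω (AxB.strip δ x) < ∞ ∧ H x ∈ N ∩ AxB.strip δ x ∧
        ∀ y ∈ N ∩ AxB.strip δ x, y ≠ H x → y.a < (H x).a) ∧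
      -- every orbit is eventually constant
      (∀ x ∈ N, ∃ k : ℕ, ∀ n ≥ k, H^[n] x = H^[k] x) ∧
      -- every fixed point is the image of infinitely many points
      (∀ y ∈ PointShift.fixedPts N H, {x ∈ N | H x = y}.Infinite) ∧
      -- foils and components coincide
      (∀ x ∈ N, PointShift.foil N H x = PointShift.component N H x) ∧
      -- components correspond to fixed points
      (∀ C ∈ PointShift.components N H, ∃! y, y ∈ C ∧ y ∈ PointShift.fixedPts N H) ∧
      (∀ y ∈ PointShift.fixedPts N H,
        PointShift.component N H y = {x ∈ N | ∃ n : ℕ, H^[n] x = y}) ∧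
      -- fixed points exist and are primeval
      (PointShift.fixedPts N H).Nonempty ∧
      PointShift.fixedPts N H ⊆ PointShift.primeval N H ∧
      -- every component has type `I/I`, yet has a cycle and primeval points, so the
      -- cardinality classification fails for every component
      (∀ C ∈ PointShift.components N H,
        PointShift.TypeII N H C ∧ ¬ PointShift.Acyclic H C ∧
          (PointShift.primeval N H ∩ C).Nonempty ∧ ¬ PointShift.Classified N H C) := by
  refine ⟨⟨AxB.haar_isHaarMeasure, AxB.haar_not_isMulRightInvariant⟩, ?_⟩
  filter_upwards [AxB.ae_strip_lt_top (δ := δ) hlam hm, AxB.ae_nonempty hlam hm,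
    AxB.ae_injOn_a hlam hm, AxB.ae_exists_mem_cone hlam hδ hm,
    AxB.ae_exists_not_strictChain hlam hδ hsub hm] with ω hfin hne hinj hcone hchain N H hNω hHN
  rw [← hNω] at hne hinj hcone hchain
  have hfin' : ∀ x, (N ∩ AxB.strip δ x).Finite := fun x => by
    rw [hNω]
    exact hm.finite_inter (hfin x)
  have hR : ∀ x ∈ N, AxB.IsRightmost δ N x (H x) := fun x hx => by
    rw [hHN]
    exact AxB.isRightmost_stripShift hδ hfin' hinj hx
  have hNH : ∀ x ∈ N, H x ∈ N := fun x hx => (hR x hx).1.1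
  have hev : ∀ x ∈ N, ∃ k : ℕ, H (H^[k] x) = H^[k] x := by
    intro x hx
    -- An orbit that never becomes stationary would start strict chains of every length.
    by_contra! h
    obtain ⟨n, hn⟩ := hchain x
    exact hn (AxB.strictChain_iterate (fun x hx => (hR x hx).1) hinj hx h n 0)
  have hinf : ∀ y ∈ PointShift.fixedPts N H, {x ∈ N | H x = y}.Infinite :=
    fun y hy => AxB.infinite_preimage_fixedPt hδ hR hinj hcone hy
  refine ⟨fun x hx => ⟨hfin x, (hR x hx).1, fun y hy hyne => ?_⟩, fun x hx => ?_, hinf,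
    fun x hx => PointShift.foil_eq_component hNH hev hx,
    fun C hC => PointShift.existsUnique_fixedPt hNH hev hC,
    fun y hy => PointShift.component_fixedPt hNH hev hy, ?_,
    PointShift.fixedPts_subset_primeval, fun C hC => ?_⟩
  · exact ((hR x hx).2 y hy).resolve_right fun h => hyne (hinj y hy.1 _ (hNH x hx) h.1)
  · obtain ⟨k, hk⟩ := hev x hx
    exact ⟨k, fun n hn => PointShift.iterate_eq_of_le hk hn⟩
  · obtain ⟨x, hx⟩ := hne
    obtain ⟨k, hk⟩ := hev x hx
    exact ⟨H^[k] x, PointShift.iterate_mem hNH hx k, hk⟩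
  · obtain ⟨y, ⟨hyC, hy⟩, -⟩ := PointShift.existsUnique_fixedPt hNH hev hC
    have h2 := PointShift.typeII_of_mem_components hNH hev hinf hC
    have hac := PointShift.not_acyclic_of_fixedPt hyC hy
    exact ⟨h2, hac, ⟨y, PointShift.fixedPts_subset_primeval hy, hyC⟩,
      PointShift.not_classified h2 hac⟩
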